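/- Let $\alpha_1,\dots,\alpha_n,\beta_1,\dots,\beta_n,c,k\ge 1$ be natural numbers with $\alpha_i\beta_i=c$ for all $i$. Let $f:\mathbb R^n\to\mathbb R^n$ be smooth and asymptotically quasi-homogeneous of type $\alpha$ and order $k+1$ at infinity: there is a smooth $F=(F_1,\dots,F_n)$ with $F_j(r^{\alpha_1}x_1,\dots,r^{\alpha_n}x_n)=r^{k+\alpha_j}F_j(x)$ for all $r\in\mathbb R$, $x\in\mathbb R^n$, such that $r^{-(k+\alpha_j)}f_j(r^{\alpha_1}x_1,\dots,r^{\alpha_n}x_n)-F_j(x)\to0$ as $r\to+\infty$, uniformly on the unit sphere $S^{n-1}$, for every $j$. Put $p(y)=\big(\sum_i y_i^{2\beta_i}\big)^{1/2c}$, $\mathcal D=\{p<1\}$, $\mathcal E=\partial\mathcal D=\{p=1\}$ (the horizon). For $y\in\mathbb R^n$ let $\kappa(y)$ be the unique zero of $\kappa^{2c}-\kappa^{2c-1}-p(y)^{2c}$ with $\kappa\ge\max\{1,p(y)\}$, and let $T:\mathbb R^n\to\mathcal D$, $T(y)_i=y_i/\kappa(y)^{\alpha_i}$ (the quasi-parabolic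 compactification). On $\overline{\mathcal D}$ let $$g_i(x)=\Big(1-\tfrac{2c-1}{2c}(1-p(x)^{2c})\Big)\tilde f_i(x)-\alpha_i x_i\sum_{j=1}^n\frac{x_j^{2\beta_j-1}}{\alpha_j}\tilde f_j(x),$$ where, for $x\in\mathcal D$ and $\kappa=(1-p(x)^{2c})^{-1}$, $\tilde f_j(x)=\kappa^{-(k+\alpha_j)}f_j(\kappa^{\alpha_1}x_1,\dots,\kappa^{\alpha_n}x_n)$, and $\tilde f_j=F_j$ on $\mathcal E$. For a trajectory $x(\tau)$ of $\dot x=g(x)$ put $$t(\tau)=\int_0^{\tau}\Big(1-\tfrac{2c-1}{2c}\big(1-p(x(\sigma))^{2c}\big)\Big)\big(1-p(x(\sigma))^{2c}\big)^k\,d\sigma .$$ Let $y_0\in\mathbb R^n$ and assume that the following validation succeeds. 1. $x_*\in\mathcal E$ and $g(x_*)=0$. 2. $Y$ is a positive definite real symmetric matrix and $\tilde N\subset\overline{\mathcal D}$ is a compact star-shaped set containing $x_*$ such that for every $x\in\tilde N$ the derivative $Dg(x)$ (relative to $\overline{\mathcal D}$) exists and $A(x)=Dg(x)^TY+Y\,Dg(x)$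 is negative definite. Put $L(x)=(x-x_*)^TY(x-x_*)$. 3. $\varepsilon>0$ is such that $N=\{x\in\overline{\mathcal D}\mid L(x)\le\varepsilon\}\subset\tilde N$, and a trajectory $x(\tau)$, $0\le\tau\le\tau_N$, of $\dot x=g(x)$ in $\overline{\mathcal D}$ with $x(0)=T(y_0)$ satisfies $L(x(\tau_N))<\varepsilon$. 4. $c_1,c_{\tilde N}>0$ satisfy $v^TA(x)v\le -c_1c_{\tilde N}\,v^TYv$ for all $x\in\tilde N$, $v\in\mathbb R^n$; the function $C$ satisfies $|1-p(x)^{2c}|\le C(L(x))$ for all $x\in\tilde N$; and $\ell\mapsto C(\ell)^k/\ell$ is integrable on $(0,\varepsilon)$, so that $\overline C(\varepsilon)=\dfrac{1}{c_{\tilde N}c_1}\displaystyle\int_0^{\varepsilon}\frac{C(\ell)^k}{\ell}\,d\ell$ is finite. Then $x_*$ is an asymptotically stable equilibrium of $\dot x=g(x)$ on $\overline{\mathcal D}$, and the solution $y(t)$ of $y'=f(y)$, $y(0)=y_0$ blows up in finite time: the supremum $t_{\max}$ of the $\bar t>0$ such that a solution exists on $[0,\bar t)$ is finite. With $t_N=t(\tau_N)$,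 $$t_{\max}\in[t_N,\;t_N+\overline C(\varepsilon)].$$ Moreover, $x(\tau)$ extends to a trajectory in $\mathcal D$ on $[0,\infty)$ with $x(\tau)\to x_*$ as $\tau\to\infty$, and $y(t(\tau))=T^{-1}(x(\tau))$ for all $\tau\ge0$, where $0\le t(\tau)<t_{\max}$ and $t(\tau)\to t_{\max}$ as $\tau\to\infty$. -/

import Mathlib

open Set Filter Topology

noncomputable section

namespace QHBlowup

/-- The anisotropic scaling `(r ^ α₁ x₁, …, r ^ αₙ xₙ)`. -/
def scale {n : ℕ} (α : Fin n → ℕ) (r : ℝ) (x : EuclideanSpace ℝ (Fin n)) :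
    EuclideanSpace ℝ (Fin n) :=
  WithLp.toLp 2 (fun i => r ^ α i * x i)

/-- `F` is a (smooth) quasi-homogeneous vector field of type `α` and order `k + 1`. -/
def IsQuasiHomogeneous {n : ℕ} (α : Fin n → ℕ) (k : ℕ)
    (F : EuclideanSpace ℝ (Fin n) → EuclideanSpace ℝ (Fin n)) : Prop :=
  ContDiff ℝ (⊤ : ℕ∞) F ∧
    ∀ (j : Fin n) (r : ℝ) (x : EuclideanSpace ℝ (Fin n)),
      F (scale α r x) j = r ^ (k + α j) * F x j

/-- `f` is a (smooth) asymptotically quasi-homogeneous vector field of type `α` and order `k + 1`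
at infinity, and `F` is the quasi-homogeneous vector field to which it is asymptotic. -/
def IsAsymptoticallyQuasiHomogeneous {n : ℕ} (α : Fin n → ℕ) (k : ℕ)
    (f F : EuclideanSpace ℝ (Fin n) → EuclideanSpace ℝ (Fin n)) : Prop :=
  ContDiff ℝ (⊤ : ℕ∞) f ∧ IsQuasiHomogeneous α k F ∧
    ∀ j : Fin n,
      TendstoUniformlyOn
        (fun (r : ℝ) (x : EuclideanSpace ℝ (Fin n)) =>
          (r ^ (k + α j))⁻¹ * (f (scale α r x) j - r ^ (k + α j) * F x j))
        (fun _ => 0) atTop (Metric.sphere 0 1)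

/-- The functional `p(y) = (∑ yᵢ ^ (2 βᵢ)) ^ (1 / (2 c))`. -/
def p {n : ℕ} (β : Fin n → ℕ) (c : ℕ) (y : EuclideanSpace ℝ (Fin n)) : ℝ :=
  (∑ i, y i ^ (2 * β i)) ^ (1 / (2 * (c : ℝ)))

/-- The domain `𝒟 = {p < 1}`; the compactified phase space is its closure. -/
def domain {n : ℕ} (β : Fin n → ℕ) (c : ℕ) : Set (EuclideanSpace ℝ (Fin n)) :=
  {x | p β c x < 1}

/-- The horizon `ℰ = {p = 1}`. -/
def horizon {n : ℕ} (β : Fin n → ℕ) (c : ℕ) : Set (EuclideanSpace ℝ (Fin n)) :=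
  {x | p β c x = 1}

/-- The condition that defines `κ(y)`: a zero of `κ ^ (2c) - κ ^ (2c-1) - p(y) ^ (2c)` with
`κ ≥ max {1, p(y)}`. -/
def IsKappa {n : ℕ} (β : Fin n → ℕ) (c : ℕ) (y : EuclideanSpace ℝ (Fin n)) (z : ℝ) : Prop :=
  max 1 (p β c y) ≤ z ∧ z ^ (2 * c) - z ^ (2 * c - 1) - p β c y ^ (2 * c) = 0

lemma existsUnique_isKappa {n : ℕ} (β : Fin n → ℕ) (c : ℕ) (hc : 0 < c)
    (y : EuclideanSpace ℝ (Fin n)) : ∃! z, IsKappa β c y z := by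
  obtain ⟨m, rfl⟩ : ∃ m, c = m + 1 := ⟨c - 1, by omega⟩
  have hm : 2 * (m + 1) - 1 = 2 * m + 1 := by omega
  have hp : 0 ≤ p β (m + 1) y := by
    refine Real.rpow_nonneg (Finset.sum_nonneg fun i _ => ?_) _
    rw [pow_mul]; positivity
  set q := p β (m + 1) y with hq
  have key : ∀ z : ℝ, z ^ (2 * (m + 1)) - z ^ (2 * (m + 1) - 1) - q ^ (2 * (m + 1))
      = z ^ (2 * m + 1) * (z - 1) - q ^ (2 * (m + 1)) := by
    intro z; rw [hm]; ring
  have hge : ∀ z : ℝ, 1 ≤ z → z ^ (2 * m + 1) * (z - 1) = q ^ (2 * (m + 1)) → q ≤ z := by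
    intro z hz h
    by_contra hlt
    push Not at hlt
    have h1 : z ^ (2 * (m + 1)) < q ^ (2 * (m + 1)) :=
      pow_lt_pow_left₀ hlt (by linarith) (by omega)
    have h2 : z ^ (2 * m + 1) * (z - 1) = z ^ (2 * (m + 1)) - z ^ (2 * m + 1) := by ring
    have h3 : 0 < z ^ (2 * m + 1) := by positivity
    linarith
  have hex : ∃ z ∈ Icc (1 : ℝ) (1 + q ^ (2 * (m + 1))),
      z ^ (2 * m + 1) * (z - 1) = q ^ (2 * (m + 1)) := by
    have hQ : 0 ≤ q ^ (2 * (m + 1)) := by positivity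
    have := intermediate_value_Icc (a := (1 : ℝ)) (b := 1 + q ^ (2 * (m + 1)))
      (f := fun z => z ^ (2 * m + 1) * (z - 1)) (by linarith) (by fun_prop)
    obtain ⟨z, hz, hz'⟩ := this (show q ^ (2 * (m + 1)) ∈ _ from by
      refine ⟨by simpa using hQ, ?_⟩
      have : 1 ≤ (1 + q ^ (2 * (m + 1))) ^ (2 * m + 1) := one_le_pow₀ (by linarith)
      simp only [add_sub_cancel_left]
      nlinarith)
    exact ⟨z, hz, hz'⟩
  obtain ⟨z, hz, hz'⟩ := hex
  refine ⟨z, ⟨max_le hz.1 (hge z hz.1 hz'), by rw [key, hz', sub_self]⟩, ?_⟩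
  rintro w ⟨hw1, hw2⟩
  have hw1' : 1 ≤ w := le_trans (le_max_left _ _) hw1
  rw [key] at hw2
  have hmono : ∀ a b : ℝ, 1 ≤ a → a < b →
      a ^ (2 * m + 1) * (a - 1) < b ^ (2 * m + 1) * (b - 1) := by
    intro a b ha hab
    have h1 : a ^ (2 * m + 1) ≤ b ^ (2 * m + 1) :=
      pow_le_pow_left₀ (by linarith) hab.le _
    have h2 : 0 < b ^ (2 * m + 1) := pow_pos (by linarith) _
    nlinarith
  rcases lt_trichotomy w z with h | h | h
  · have := hmono w z hw1' h; linarith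
  · exact h
  · have := hmono z w hz.1 h; linarith

/-- The functional `κ(y)` of the quasi-parabolic compactification: the unique `z` with
`IsKappa β c y z` (see `existsUnique_isKappa`). -/
def kappa {n : ℕ} (β : Fin n → ℕ) (c : ℕ) (y : EuclideanSpace ℝ (Fin n)) : ℝ :=
  Classical.epsilon (IsKappa β c y)

lemma kappa_spec {n : ℕ} (β : Fin n → ℕ) (c : ℕ) (hc : 0 < c)
    (y : EuclideanSpace ℝ (Fin n)) : IsKappa β c y (kappa β c y) :=
  Classical.epsilon_spec (existsUnique_isKappa β c hc y).exists

/-- The quasi-parabolic compactification `T(y)ᵢ = yᵢ / κ(y) ^ αᵢ`. -/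
def Tpara {n : ℕ} (α β : Fin n → ℕ) (c : ℕ) (y : EuclideanSpace ℝ (Fin n)) :
    EuclideanSpace ℝ (Fin n) :=
  WithLp.toLp 2 (fun i => y i / kappa β c y ^ α i)

/-- `f̃ⱼ(x) = κ ^ (-(k + αⱼ)) fⱼ(κ ^ α₁ x₁, …, κ ^ αₙ xₙ)` with `κ = (1 - p(x) ^ (2c))⁻¹` on `𝒟`;
on the horizon it is the limit value, namely the asymptotic quasi-homogeneous part `F`. -/
def tildeF {n : ℕ} (α β : Fin n → ℕ) (c k : ℕ)
    (f F : EuclideanSpace ℝ (Fin n) → EuclideanSpace ℝ (Fin n))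
    (x : EuclideanSpace ℝ (Fin n)) (j : Fin n) : ℝ :=
  open Classical in
  if x ∈ domain β c then
    (((1 - p β c x ^ (2 * c))⁻¹) ^ (k + α j))⁻¹ *
      f (scale α ((1 - p β c x ^ (2 * c))⁻¹) x) j
  else F x j

/-- The factor `1 - (2c-1)/(2c) κ⁻¹`, with `κ⁻¹ = 1 - p(x) ^ (2c)`. -/
def timeFactor {n : ℕ} (β : Fin n → ℕ) (c : ℕ) (x : EuclideanSpace ℝ (Fin n)) : ℝ :=
  1 - (2 * (c : ℝ) - 1) / (2 * (c : ℝ)) * (1 - p β c x ^ (2 * c))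

/-- The desingularized vector field on `closure 𝒟` of the quasi-parabolic compactification with
the time variable `dτ = κ ^ k (1 - (2c-1)/(2c) κ⁻¹)⁻¹ dt`. -/
def desing {n : ℕ} (α β : Fin n → ℕ) (c k : ℕ)
    (f F : EuclideanSpace ℝ (Fin n) → EuclideanSpace ℝ (Fin n))
    (x : EuclideanSpace ℝ (Fin n)) : EuclideanSpace ℝ (Fin n) :=
  WithLp.toLp 2 (fun i =>
    timeFactor β c x * tildeF α β c k f F x i
      - (α i : ℝ) * x i *
        ∑ j, x j ^ (2 * β j - 1) / (α j : ℝ) * tildeF α β c k f F x j)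

/-- The density `dt / dτ` at the point `x`. -/
def timeDensity {n : ℕ} (β : Fin n → ℕ) (c k : ℕ) (x : EuclideanSpace ℝ (Fin n)) : ℝ :=
  timeFactor β c x * (1 - p β c x ^ (2 * c)) ^ k

/-- The original time `t = ∫₀^τ (dt / dτ) dτ` elapsed along the curve `x` up to `τ`. -/
def elapsed {n : ℕ} (β : Fin n → ℕ) (c k : ℕ) (x : ℝ → EuclideanSpace ℝ (Fin n)) (τ : ℝ) : ℝ :=
  ∫ σ in (0 : ℝ)..τ, timeDensity β c k (x σ)

/-- `x` is a trajectory of `v` in the phase space `K` on the time interval `I`. -/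
def IsTrajectoryOn {n : ℕ} (v : EuclideanSpace ℝ (Fin n) → EuclideanSpace ℝ (Fin n))
    (K : Set (EuclideanSpace ℝ (Fin n))) (I : Set ℝ) (x : ℝ → EuclideanSpace ℝ (Fin n)) : Prop :=
  ∀ t ∈ I, x t ∈ K ∧ HasDerivWithinAt x (v (x t)) I t

/-- The Jacobian matrix at `x` of a vector field defined on `K` (one-sided at boundary points). -/
def jacobian {n : ℕ} (v : EuclideanSpace ℝ (Fin n) → EuclideanSpace ℝ (Fin n))
    (K : Set (EuclideanSpace ℝ (Fin n))) (x : EuclideanSpace ℝ (Fin n)) :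
    Matrix (Fin n) (Fin n) ℝ :=
  Matrix.of fun i j => (fderivWithin ℝ v K x (EuclideanSpace.single j 1)) i

/-- `A(x) = Dv(x)ᵀ Y + Y Dv(x)`. -/
def lyapMatrix {n : ℕ} (v : EuclideanSpace ℝ (Fin n) → EuclideanSpace ℝ (Fin n))
    (K : Set (EuclideanSpace ℝ (Fin n))) (Y : Matrix (Fin n) (Fin n) ℝ)
    (x : EuclideanSpace ℝ (Fin n)) : Matrix (Fin n) (Fin n) ℝ :=
  (jacobian v K x).transpose * Y + Y * jacobian v K x

/-- The quadratic form `vᵀ M v`. -/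
def quad {n : ℕ} (M : Matrix (Fin n) (Fin n) ℝ) (v : EuclideanSpace ℝ (Fin n)) : ℝ :=
  ∑ i, ∑ j, v i * M i j * v j

/-- `Nt` is a Lyapunov domain in `K` of the equilibrium `xs` of `v` with the matrix `Y`: a compact
star-shaped set containing `xs`, on which `A(x)` is negative definite. (Where `v` is not
differentiable, `jacobian` is zero and `A(x)` is not negative definite, so differentiability of `v`
at the points of `Nt` is part of the condition.) -/
def IsLyapunovDomain {n : ℕ} (v : EuclideanSpace ℝ (Fin n) → EuclideanSpace ℝ (Fin n))
    (K : Set (EuclideanSpace ℝ (Fin n))) (Y : Matrix (Fin n) (Fin n) ℝ)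
    (xs : EuclideanSpace ℝ (Fin n)) (Nt : Set (EuclideanSpace ℝ (Fin n))) : Prop :=
  Nt ⊆ K ∧ IsCompact Nt ∧ (∃ z ∈ Nt, StarConvex ℝ z Nt) ∧ xs ∈ Nt ∧
    ∀ x ∈ Nt, (-(lyapMatrix v K Y x)).PosDef

/-- The set of `b > 0` such that the initial value problem `y' = f(y)`, `y(0) = y₀` has a solution
on `[0, b)`. -/
def existenceTimes {n : ℕ} (f : EuclideanSpace ℝ (Fin n) → EuclideanSpace ℝ (Fin n))
    (y₀ : EuclideanSpace ℝ (Fin n)) : Set ℝ :=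
  {b | 0 < b ∧ ∃ y : ℝ → EuclideanSpace ℝ (Fin n),
    y 0 = y₀ ∧ IsTrajectoryOn f univ (Ico 0 b) y}

/-- The solution of `y' = f(y)`, `y(0) = y₀` blows up in finite time, with blow-up time `tmax`:
the supremum of the existence times is the (finite) number `tmax`. -/
def IsBlowUpTime {n : ℕ} (f : EuclideanSpace ℝ (Fin n) → EuclideanSpace ℝ (Fin n))
    (y₀ : EuclideanSpace ℝ (Fin n)) (tmax : ℝ) : Prop :=
  IsLUB (existenceTimes f y₀) tmax

/-- `xs` is an asymptotically stable equilibrium of `v` in the phase space `K`. -/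
def IsAsymptoticallyStable {n : ℕ} (v : EuclideanSpace ℝ (Fin n) → EuclideanSpace ℝ (Fin n))
    (K : Set (EuclideanSpace ℝ (Fin n))) (xs : EuclideanSpace ℝ (Fin n)) : Prop :=
  v xs = 0 ∧
  (∀ r > 0, ∃ δ > 0, ∀ (b : ℝ) (x : ℝ → EuclideanSpace ℝ (Fin n)),
    IsTrajectoryOn v K (Ico 0 b) x → ‖x 0 - xs‖ < δ → ∀ τ ∈ Ico 0 b, ‖x τ - xs‖ < r) ∧
  (∃ δ > 0, ∀ x : ℝ → EuclideanSpace ℝ (Fin n),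
    IsTrajectoryOn v K (Ici 0) x → ‖x 0 - xs‖ < δ → Tendsto x atTop (𝓝 xs))

end QHBlowup

end

/-!
Write `P(x) = ∑ xᵢ ^ (2 βᵢ) = p(x) ^ (2c)`, `q = 1 - P` and `g` for the desingularized field.  A
direct computation gives `∇P · g = S q` with `S` the function `radial` (`sum_grad_mul_desing`).
Asymptotic quasi-homogeneity makes `S` bounded on `𝒟` (`exists_radial_bound`), so `|q̇| ≤ M q` along
trajectories: `q` stays positive, and decays at most exponentially (`defect_lower_bound`).  As `g` is
`C¹` on `𝒟`, trajectories in `𝒟` are unique and, after cutting `g` off near the horizon, exist for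
all positive times (`desing_eqOn`, `exists_global_trajectory`).  In particular the given trajectory
extends to a global trajectory `X` in `𝒟`.

The mean value theorem on the segment from `x_*` turns the matrix inequality into
`d/dτ L(x(τ)) ≤ -c₁ c_N L(x(τ))` on the convex set `N` (`two_mul_bil_le`).  Hence `N` is invariant and
`L` decays exponentially, which gives asymptotic stability and `X → x_*`.

The original time satisfies `dt/dτ ≤ q ^ k ≤ C(L) ^ k`, and the substitution `ℓ = L(X(τ))` bounds the
time spent after `τ_N` by the integral of `C(ℓ) ^ k / (c₁ c_N ℓ)` over the levels attained
(`integral_le_of_deriv_le`).  To pass to the integral over all of `(0, ε)` one needs `C ≥ 0` there, so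
every level in `(0, ε]` must be attained on the phase space: otherwise the horizon would lie in `N`,
but at a maximum of `L` on the horizon the derivative of `L` along `g` vanishes, because `g` is tangent
to the horizon; this forces `L = 0` on the whole horizon, which contains `-x_*` (`exists_quad_eq`).

Finally `y = T⁻¹(X)` satisfies `dy/dτ = (dt/dτ) f(y)` (`hasDerivWithinAt_Tinv`); inverting the change
of time gives the solution on `[0, tmax)` with `tmax` the limit of the elapsed time.  It has no
continuation, since `P(X) = q ^ (2c) P(y)` would tend to `0` instead of `1` if `y` converged at `tmax`
(`exists_blowUp_of_tendsto_horizon`).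
-/

namespace QHBlowup

/-! ### The polynomial `∑ xᵢ ^ (2 βᵢ)` and the compactified phase space -/

/-- The polynomial `∑ xᵢ ^ (2 βᵢ) = p(x) ^ (2c)`. -/
noncomputable def pSum {n : ℕ} (β : Fin n → ℕ) (x : EuclideanSpace ℝ (Fin n)) : ℝ :=
  ∑ i, x i ^ (2 * β i)

section PSum

variable {n : ℕ} {β : Fin n → ℕ} {c : ℕ}

lemma pSum_nonneg (x : EuclideanSpace ℝ (Fin n)) : 0 ≤ pSum β x :=
  Finset.sum_nonneg fun i _ => by rw [pow_mul]; positivity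

lemma p_nonneg (x : EuclideanSpace ℝ (Fin n)) : 0 ≤ p β c x :=
  Real.rpow_nonneg (pSum_nonneg x) _

lemma p_pow (hc : 0 < c) (x : EuclideanSpace ℝ (Fin n)) : p β c x ^ (2 * c) = pSum β x := by
  have h := Real.rpow_inv_natCast_pow (n := 2 * c) (pSum_nonneg (β := β) x) (by omega)
  simpa [p, pSum, one_div] using h

lemma mem_domain_iff (hc : 0 < c) {x : EuclideanSpace ℝ (Fin n)} :
    x ∈ domain β c ↔ pSum β x < 1 := by
  rw [← p_pow hc, pow_lt_one_iff_of_nonneg (p_nonneg x) (by omega)]; rfl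

lemma mem_horizon_iff (hc : 0 < c) {x : EuclideanSpace ℝ (Fin n)} :
    x ∈ horizon β c ↔ pSum β x = 1 := by
  rw [← p_pow hc, pow_eq_one_iff_of_nonneg (p_nonneg x) (by omega)]; rfl

lemma contDiff_pSum {m : WithTop ℕ∞} : ContDiff ℝ m (pSum β) := by
  unfold pSum; fun_prop

lemma continuous_pSum : Continuous (pSum β) := (contDiff_pSum (m := 0)).continuous

lemma convexOn_pSum : ConvexOn ℝ univ (pSum β) := by
  refine ⟨convex_univ, fun x _ y _ a b ha hb hab => ?_⟩
  simp only [pSum, smul_eq_mul, Finset.mul_sum, ← Finset.sum_add_distrib]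
  refine Finset.sum_le_sum fun i _ => ?_
  have := (Even.convexOn_pow (𝕜 := ℝ) (even_two_mul (β i))).2 (mem_univ (x i)) (mem_univ (y i))
    ha hb hab
  simpa using this

lemma convex_pSum_le (r : ℝ) : Convex ℝ {x | pSum β x ≤ r} := by
  simpa using (convexOn_pSum (β := β)).convex_le r

lemma pSum_smul_le (hβ : ∀ i, 0 < β i) {s : ℝ} (hs : 0 ≤ s) (hs1 : s ≤ 1)
    (x : EuclideanSpace ℝ (Fin n)) : pSum β (s • x) ≤ s * pSum β x := by
  simp only [pSum, Finset.mul_sum]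
  refine Finset.sum_le_sum fun i _ => ?_
  have h1 : s ^ (2 * β i) ≤ s := pow_le_of_le_one hs hs1 (by have := hβ i; omega)
  have h2 : 0 ≤ x i ^ (2 * β i) := by rw [pow_mul]; positivity
  simpa [mul_pow] using mul_le_mul_of_nonneg_right h1 h2

lemma closure_domain (hβ : ∀ i, 0 < β i) (hc : 0 < c) :
    closure (domain β c) = {x | pSum β x ≤ 1} := by
  refine Subset.antisymm (closure_minimal (fun x hx => ((mem_domain_iff hc).1 hx).le)
    (isClosed_le continuous_pSum continuous_const)) fun x (hx : pSum β x ≤ 1) => ?_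
  have hcont : Tendsto (fun s : ℝ => s • x) (𝓝[<] 1) (𝓝 x) := by
    have : Continuous (fun s : ℝ => s • x) := by fun_prop
    simpa using (this.tendsto 1).mono_left nhdsWithin_le_nhds
  refine mem_closure_of_tendsto hcont ?_
  filter_upwards [Ioo_mem_nhdsLT (zero_lt_one' ℝ)] with s hs
  rw [mem_domain_iff hc]
  have := pSum_smul_le hβ hs.1.le hs.2.le x
  nlinarith [hs.1, hs.2, pSum_nonneg (β := β) x]

lemma abs_apply_le_one (hβ : ∀ i, 0 < β i) {x : EuclideanSpace ℝ (Fin n)} (hx : pSum β x ≤ 1)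
    (i : Fin n) : |x i| ≤ 1 := by
  have h1 : x i ^ (2 * β i) ≤ pSum β x :=
    Finset.single_le_sum (f := fun i => x i ^ (2 * β i))
      (fun j _ => by rw [pow_mul]; positivity) (Finset.mem_univ i)
  have h2 : |x i| ^ (2 * β i) ≤ 1 := by
    rw [(even_two_mul (β i)).pow_abs]; exact h1.trans hx
  exact (pow_le_one_iff_of_nonneg (abs_nonneg _) (by have := hβ i; omega)).1 h2

lemma isCompact_pSum_le (hβ : ∀ i, 0 < β i) {r : ℝ} (hr : r ≤ 1) :
    IsCompact {x | pSum β x ≤ r} := by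
  refine Metric.isCompact_of_isClosed_isBounded
    (isClosed_le continuous_pSum continuous_const) ?_
  refine isBounded_iff_forall_norm_le.2 ⟨√n, fun x (hx : pSum β x ≤ r) => ?_⟩
  rw [EuclideanSpace.norm_eq]
  refine Real.sqrt_le_sqrt ?_
  calc ∑ i, ‖x i‖ ^ 2 ≤ ∑ _i : Fin n, (1 : ℝ) := Finset.sum_le_sum fun i _ =>
        pow_le_one₀ (norm_nonneg _) (abs_apply_le_one hβ (hx.trans hr) i)
    _ = n := by simp

lemma scale_apply (α : Fin n → ℕ) (r : ℝ) (x : EuclideanSpace ℝ (Fin n)) (i : Fin n) :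
    scale α r x i = r ^ α i * x i := rfl

lemma scale_scale (α : Fin n → ℕ) (r s : ℝ) (x : EuclideanSpace ℝ (Fin n)) :
    scale α r (scale α s x) = scale α (r * s) x := by
  ext i; simp [scale_apply, mul_pow, mul_assoc]

lemma scale_one (α : Fin n → ℕ) (x : EuclideanSpace ℝ (Fin n)) : scale α 1 x = x := by
  ext i; simp [scale_apply]

lemma pSum_scale {α : Fin n → ℕ} (hαβ : ∀ i, α i * β i = c) (r : ℝ)
    (x : EuclideanSpace ℝ (Fin n)) : pSum β (scale α r x) = r ^ (2 * c) * pSum β x := by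
  simp only [pSum, Finset.mul_sum, scale_apply]
  refine Finset.sum_congr rfl fun i _ => ?_
  rw [mul_pow, ← pow_mul, ← hαβ i]; ring_nf

lemma contDiff_scale (α : Fin n → ℕ) {m : WithTop ℕ∞} :
    ContDiff ℝ m fun z : ℝ × EuclideanSpace ℝ (Fin n) => scale α z.1 z.2 := by
  rw [contDiff_euclidean]
  intro i
  simp only [scale_apply]
  fun_prop

end PSum

/-! ### Derivatives of curves in Euclidean space -/

lemma hasDerivWithinAt_euclidean {n : ℕ} {x : ℝ → EuclideanSpace ℝ (Fin n)}
    {v : EuclideanSpace ℝ (Fin n)} {s : Set ℝ} {t : ℝ} :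
    HasDerivWithinAt x v s t ↔ ∀ i, HasDerivWithinAt (fun τ => x τ i) (v i) s t := by
  simp only [hasDerivWithinAt_iff_hasFDerivWithinAt]
  rw [hasFDerivWithinAt_euclidean]
  refine forall_congr' fun i => ?_
  congr! 1

section Field

variable {n : ℕ} {α β : Fin n → ℕ} {c k : ℕ}
  {f F : EuclideanSpace ℝ (Fin n) → EuclideanSpace ℝ (Fin n)}

/-- The radial component `∑ⱼ xⱼ ^ (2 βⱼ - 1) f̃ⱼ(x) / αⱼ`, which governs the motion of `p` along
trajectories of the desingularized field. -/
noncomputable def radial (α β : Fin n → ℕ) (c k : ℕ)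
    (f F : EuclideanSpace ℝ (Fin n) → EuclideanSpace ℝ (Fin n))
    (x : EuclideanSpace ℝ (Fin n)) : ℝ :=
  ∑ j, x j ^ (2 * β j - 1) / (α j : ℝ) * tildeF α β c k f F x j

lemma timeFactor_eq (hc : 0 < c) (x : EuclideanSpace ℝ (Fin n)) :
    timeFactor β c x = 1 - (2 * (c : ℝ) - 1) / (2 * (c : ℝ)) * (1 - pSum β x) := by
  rw [timeFactor, p_pow hc]

lemma desing_apply (x : EuclideanSpace ℝ (Fin n)) (i : Fin n) :
    desing α β c k f F x i =
      timeFactor β c x * tildeF α β c k f F x i - α i * x i * radial α β c k f F x := rfl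

/-- The derivative of `∑ xᵢ ^ (2 βᵢ)` in the direction of the desingularized field; it vanishes on
the horizon. -/
lemma sum_grad_mul_desing (hα : ∀ i, 0 < α i) (hβ : ∀ i, 0 < β i) (hc : 0 < c)
    (hαβ : ∀ i, α i * β i = c) (x : EuclideanSpace ℝ (Fin n)) :
    ∑ i, (2 * β i : ℕ) * x i ^ (2 * β i - 1) * desing α β c k f F x i
      = radial α β c k f F x * (1 - pSum β x) := by
  have hc' : (c : ℝ) ≠ 0 := by positivity
  have h1 : ∀ i, (2 * β i : ℕ) * x i ^ (2 * β i - 1) * desing α β c k f F x i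
      = 2 * c * timeFactor β c x * (x i ^ (2 * β i - 1) / (α i : ℝ) * tildeF α β c k f F x i)
        - 2 * c * radial α β c k f F x * x i ^ (2 * β i) := by
    intro i
    have hα' : (α i : ℝ) ≠ 0 := by have := hα i; positivity
    have h2 : x i ^ (2 * β i) = x i ^ (2 * β i - 1) * x i := by
      rw [← pow_succ]; congr 1; have := hβ i; omega
    have h3 : (c : ℝ) = α i * β i := by rw [← hαβ i]; push_cast; ring
    rw [desing_apply, h2, h3]
    push_cast
    field_simp
  rw [Finset.sum_congr rfl fun i _ => h1 i, Finset.sum_sub_distrib, ← Finset.mul_sum,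
    ← Finset.mul_sum]
  change 2 * c * timeFactor β c x * radial α β c k f F x
    - 2 * c * radial α β c k f F x * pSum β x = _
  rw [timeFactor_eq hc]
  field_simp
  ring

lemma hasDerivWithinAt_pSum {x : ℝ → EuclideanSpace ℝ (Fin n)} {v : EuclideanSpace ℝ (Fin n)}
    {s : Set ℝ} {t : ℝ} (h : HasDerivWithinAt x v s t) :
    HasDerivWithinAt (fun τ => pSum β (x τ))
      (∑ i, (2 * β i : ℕ) * x t i ^ (2 * β i - 1) * v i) s t := by
  simp only [pSum]
  exact HasDerivWithinAt.fun_sum fun i _ => (hasDerivWithinAt_euclidean.1 h i).fun_pow _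

lemma tildeF_of_mem (hc : 0 < c) {x : EuclideanSpace ℝ (Fin n)} (hx : pSum β x < 1) (j : Fin n) :
    tildeF α β c k f F x j =
      (((1 - pSum β x)⁻¹) ^ (k + α j))⁻¹ * f (scale α (1 - pSum β x)⁻¹ x) j := by
  rw [tildeF, if_pos ((mem_domain_iff hc).2 hx), p_pow hc]

lemma contDiffOn_tildeF (hc : 0 < c) (hf : ContDiff ℝ (⊤ : ℕ∞) f) (j : Fin n) :
    ContDiffOn ℝ 1 (fun x => tildeF α β c k f F x j) {x | pSum β x < 1} := by
  have hf1 : ContDiff ℝ 1 f := hf.of_le (by exact_mod_cast le_top)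
  have hq : ContDiffOn ℝ 1 (fun x => (1 - pSum β x)⁻¹) {x | pSum β x < 1} := by
    refine ContDiffOn.inv (contDiff_const.sub contDiff_pSum).contDiffOn fun x hx => ?_
    exact (sub_pos.2 hx).ne'
  have h1 : ContDiffOn ℝ 1 (fun x => f (scale α (1 - pSum β x)⁻¹ x)) {x | pSum β x < 1} :=
    (hf1.comp (contDiff_scale α)).comp_contDiffOn (hq.prodMk contDiffOn_id)
  have h2 : ContDiffOn ℝ 1 (fun x => f (scale α (1 - pSum β x)⁻¹ x) j) {x | pSum β x < 1} :=
    contDiffOn_euclidean.1 h1 j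
  refine (((hq.pow (k + α j)).inv fun x hx => ?_).mul h2).congr fun x hx => tildeF_of_mem hc hx j
  exact pow_ne_zero _ (inv_ne_zero (sub_pos.2 hx).ne')

lemma contDiffOn_desing (hc : 0 < c) (hf : ContDiff ℝ (⊤ : ℕ∞) f) :
    ContDiffOn ℝ 1 (desing α β c k f F) {x | pSum β x < 1} := by
  have htf : ContDiff ℝ 1 (fun x : EuclideanSpace ℝ (Fin n) => timeFactor β c x) := by
    simp only [timeFactor_eq hc]
    exact contDiff_const.sub (contDiff_const.mul (contDiff_const.sub contDiff_pSum))
  have ht := fun j => contDiffOn_tildeF (α := α) (β := β) (k := k) (F := F) hc hf j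
  rw [contDiffOn_euclidean]
  intro i
  simp only [desing_apply, radial]
  refine (htf.contDiffOn.mul (ht i)).sub (ContDiffOn.mul ?_ ?_)
  · exact ContDiff.contDiffOn (by fun_prop)
  · refine ContDiffOn.sum fun j _ => ContDiffOn.mul ?_ (ht j)
    exact ContDiff.contDiffOn (by fun_prop)

end Field

/-! ### Boundedness of the radial component -/

section Growth

variable {n : ℕ} {α β : Fin n → ℕ} {c k : ℕ}
  {f F : EuclideanSpace ℝ (Fin n) → EuclideanSpace ℝ (Fin n)}

/-- Every nonzero orbit of the anisotropic scaling meets the unit sphere. -/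
lemma exists_norm_scale_eq_one (hα : ∀ i, 0 < α i) {y : EuclideanSpace ℝ (Fin n)} (hy : y ≠ 0) :
    ∃ s : ℝ, 0 < s ∧ ‖scale α s y‖ = 1 := by
  obtain ⟨i, hi⟩ : ∃ i, y i ≠ 0 := by
    by_contra! h
    exact hy (by ext i; simpa using h i)
  have hcont : Continuous fun s : ℝ => ‖scale α s y‖ :=
    ((contDiff_scale α (m := 0)).continuous.comp (by fun_prop : Continuous fun s : ℝ => (s, y))).norm
  have h0 : scale α 0 y = 0 := by
    ext j; simp [scale_apply, (hα j).ne']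
  have hpos : 0 < |y i| := abs_pos.2 hi
  have h1 : 1 ≤ ‖scale α (1 + |y i|⁻¹) y‖ := by
    refine le_trans ?_ (PiLp.norm_apply_le (scale α (1 + |y i|⁻¹) y) i)
    have hs : 1 ≤ 1 + |y i|⁻¹ := by have := inv_pos.2 hpos; linarith
    rw [scale_apply, Real.norm_eq_abs, abs_mul, abs_pow, abs_of_nonneg (by linarith)]
    calc (1 : ℝ) ≤ (1 + |y i|⁻¹) * |y i| := by rw [add_mul, inv_mul_cancel₀ hpos.ne']; linarith
      _ ≤ _ := mul_le_mul_of_nonneg_right (le_self_pow₀ hs (hα i).ne') hpos.le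
  obtain ⟨s, hs, hs'⟩ := intermediate_value_Icc (a := (0 : ℝ)) (b := 1 + |y i|⁻¹) (by positivity)
    hcont.continuousOn (show (1 : ℝ) ∈ _ from ⟨by simp [h0], h1⟩)
  refine ⟨s, lt_of_le_of_ne hs.1 ?_, hs'⟩
  rintro rfl
  simp [h0] at hs'

lemma pSum_pos {x : EuclideanSpace ℝ (Fin n)} (hx : x ≠ 0) :
    0 < pSum β x := by
  obtain ⟨i, hi⟩ : ∃ i, x i ≠ 0 := by
    by_contra! h
    exact hx (by ext i; simpa using h i)
  refine lt_of_lt_of_le ?_ (Finset.single_le_sum (f := fun i => x i ^ (2 * β i))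
      (fun j _ => by rw [pow_mul]; positivity) (Finset.mem_univ i))
  show 0 < x i ^ (2 * β i)
  rw [pow_mul]; positivity

/-- An asymptotically quasi-homogeneous field grows at most at the rate prescribed by its order;
`K` bounds the quasi-homogeneous size `p(y)`. -/
lemma exists_growth_bound (hα : ∀ i, 0 < α i) (hc : 0 < c)
    (hαβ : ∀ i, α i * β i = c) (hf : IsAsymptoticallyQuasiHomogeneous α k f F) (j : Fin n) :
    ∃ M : ℝ, 0 ≤ M ∧ ∀ (y : EuclideanSpace ℝ (Fin n)) (K : ℝ), 1 ≤ K → pSum β y ≤ K ^ (2 * c) →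
      |f y j| ≤ M * K ^ (k + α j) := by
  obtain ⟨hfs, ⟨hFs, -⟩, hlim⟩ := hf
  obtain ⟨R, hR⟩ := eventually_atTop.1 (Metric.tendstoUniformlyOn_iff.1 (hlim j) 1 one_pos)
  have hsph : IsCompact (Metric.sphere (0 : EuclideanSpace ℝ (Fin n)) 1) := isCompact_sphere _ _
  obtain ⟨MF, hMF⟩ := hsph.exists_bound_of_continuousOn hFs.continuous.continuousOn
  obtain ⟨m, hm0, hm⟩ := hsph.exists_forall_le' (f := pSum β) continuous_pSum.continuousOn (a := 0)
    fun u hu => pSum_pos (by rintro rfl; simp at hu)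
  obtain ⟨M0, hM0⟩ := ((isCompact_Icc (a := 0) (b := max R 1)).prod
    (isCompact_closedBall (0 : EuclideanSpace ℝ (Fin n)) 1)).exists_bound_of_continuousOn
    (hfs.continuous.comp (contDiff_scale α (m := 0)).continuous).continuousOn
  -- `B` is chosen so that `pSum (scale r u) ≤ K ^ (2c)` with `‖u‖ = 1` forces `r ≤ B K`.
  set B := max 1 m⁻¹ with hB
  have hB1 : 1 ≤ B := le_max_left _ _
  refine ⟨max M0 0 + (1 + max MF 0) * B ^ (k + α j), by positivity, fun y K hK hy => ?_⟩
  have hKe : 1 ≤ K ^ (k + α j) := one_le_pow₀ hK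
  have hsmall : ∀ r ∈ Icc 0 (max R 1), ∀ u : EuclideanSpace ℝ (Fin n), ‖u‖ ≤ 1 →
      y = scale α r u → |f y j| ≤ (max M0 0 + (1 + max MF 0) * B ^ (k + α j)) * K ^ (k + α j) := by
    rintro r hr u hu rfl
    have h1 : |f (scale α r u) j| ≤ max M0 0 :=
      ((PiLp.norm_apply_le (f (scale α r u)) j).trans
        (hM0 (r, u) ⟨hr, by simpa using hu⟩)).trans (le_max_left _ _)
    have h2 : 0 ≤ (1 + max MF 0) * B ^ (k + α j) := by positivity
    have h3 : 0 ≤ max M0 0 := le_max_right _ _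
    nlinarith
  rcases eq_or_ne y 0 with rfl | hy0
  · refine hsmall 1 ⟨zero_le_one, le_max_right _ _⟩ 0 (by simp) (by ext i; simp [scale_apply])
  obtain ⟨s, hs, hs1⟩ := exists_norm_scale_eq_one hα hy0
  have hyu : y = scale α s⁻¹ (scale α s y) := by
    rw [scale_scale, inv_mul_cancel₀ hs.ne', scale_one]
  set u := scale α s y
  have hr : 0 < s⁻¹ := inv_pos.2 hs
  set r := s⁻¹
  rcases le_total r (max R 1) with hrR | hrR
  · exact hsmall r ⟨hr.le, hrR⟩ u hs1.le hyu
  have hu : u ∈ Metric.sphere (0 : EuclideanSpace ℝ (Fin n)) 1 := by simpa using hs1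
  have hrK : r ≤ B * K := by
    refine le_of_pow_le_pow_left₀ (n := 2 * c) (by omega) (by positivity) ?_
    have h1 : r ^ (2 * c) * m ≤ K ^ (2 * c) := by
      refine le_trans ?_ hy
      rw [hyu, pSum_scale hαβ]
      exact mul_le_mul_of_nonneg_left (hm u hu) (by positivity)
    have h2 : 1 ≤ B ^ (2 * c) * m := by
      have h3 : B ≤ B ^ (2 * c) := le_self_pow₀ hB1 (by omega)
      have h4 : m⁻¹ ≤ B := le_max_right _ _
      calc (1 : ℝ) = m⁻¹ * m := (inv_mul_cancel₀ hm0.ne').symm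
        _ ≤ B ^ (2 * c) * m := mul_le_mul_of_nonneg_right (h4.trans h3) hm0.le
    rw [mul_pow]
    have h5 : 0 ≤ B ^ (2 * c) := by positivity
    have h6 : 0 ≤ r ^ (2 * c) := by positivity
    nlinarith [mul_le_mul_of_nonneg_left h1 h5, mul_le_mul_of_nonneg_left h2 h6]
  have hre : 0 < r ^ (k + α j) := by positivity
  have h1 : |f y j| ≤ (1 + max MF 0) * r ^ (k + α j) := by
    have h2 := hR r ((le_max_left _ _).trans hrR) u hu
    rw [← hyu] at h2
    have h3 : |F u j| ≤ max MF 0 :=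
      ((PiLp.norm_apply_le (F u) j).trans (hMF u hu)).trans (le_max_left _ _)
    simp only [dist_zero_left, Real.norm_eq_abs, abs_mul, abs_inv, abs_of_pos hre] at h2
    rw [inv_mul_lt_iff₀ hre, mul_one] at h2
    have h4 := abs_sub_abs_le_abs_sub (f y j) (r ^ (k + α j) * F u j)
    rw [abs_mul, abs_of_pos hre] at h4
    nlinarith [mul_le_mul_of_nonneg_left h3 hre.le]
  calc |f y j| ≤ (1 + max MF 0) * r ^ (k + α j) := h1
    _ ≤ (1 + max MF 0) * (B * K) ^ (k + α j) := by gcongr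
    _ = (1 + max MF 0) * B ^ (k + α j) * K ^ (k + α j) := by rw [mul_pow]; ring
    _ ≤ _ := by
      refine mul_le_mul_of_nonneg_right ?_ (by positivity)
      have : 0 ≤ max M0 0 := le_max_right _ _
      linarith

lemma exists_radial_bound (hα : ∀ i, 0 < α i) (hβ : ∀ i, 0 < β i) (hc : 0 < c)
    (hαβ : ∀ i, α i * β i = c) (hf : IsAsymptoticallyQuasiHomogeneous α k f F) :
    ∃ M : ℝ, 0 ≤ M ∧ ∀ x : EuclideanSpace ℝ (Fin n), pSum β x < 1 →
      |radial α β c k f F x| ≤ M := by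
  choose M hM0 hM using exists_growth_bound hα hc hαβ hf
  refine ⟨∑ j, M j, Finset.sum_nonneg fun j _ => hM0 j, fun x hx => ?_⟩
  refine (Finset.abs_sum_le_sum_abs _ _).trans (Finset.sum_le_sum fun j _ => ?_)
  have hq : 0 < 1 - pSum β x := sub_pos.2 hx
  have hκ : 1 ≤ (1 - pSum β x)⁻¹ :=
    (one_le_inv₀ hq).2 (by linarith [pSum_nonneg (β := β) x])
  have h1 : |tildeF α β c k f F x j| ≤ M j := by
    have h2 := hM j (scale α (1 - pSum β x)⁻¹ x) _ hκ (by
      rw [pSum_scale hαβ]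
      exact mul_le_of_le_one_right (by positivity) hx.le)
    rw [tildeF_of_mem hc hx, abs_mul, abs_of_pos (by positivity), inv_mul_le_iff₀ (by positivity)]
    linarith
  have h3 : |x j ^ (2 * β j - 1) / (α j : ℝ)| ≤ 1 := by
    have hα1 : (1 : ℝ) ≤ α j := by exact_mod_cast hα j
    rw [abs_div, abs_pow, abs_of_pos (by linarith : (0 : ℝ) < α j)]
    exact div_le_one_of_le₀ ((pow_le_one₀ (abs_nonneg _) (abs_apply_le_one hβ hx.le j)).trans hα1)
      (by linarith)
  rw [abs_mul]
  calc _ ≤ 1 * |tildeF α β c k f F x j| := mul_le_mul_of_nonneg_right h3 (abs_nonneg _)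
    _ ≤ M j := by rw [one_mul]; exact h1

end Growth

/-! ### Global existence, uniqueness and invariance of the interior of the phase space -/

/-- If `q' ≥ -M q` as long as `q > 0`, then `q` stays positive. -/
lemma mul_exp_le_of_deriv_ge {q q' : ℝ → ℝ} {T M : ℝ} (hq : ContinuousOn q (Icc 0 T))
    (hq' : ∀ t ∈ Ico 0 T, HasDerivWithinAt q (q' t) (Ici t) t) (h0 : 0 < q 0)
    (hM : ∀ t ∈ Ico 0 T, 0 < q t → -M * q t ≤ q' t) :
    ∀ t ∈ Icc 0 T, q 0 * Real.exp (-(M + 1) * t) ≤ q t := by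
  intro t ht
  have hB : ∀ t : ℝ, HasDerivAt (fun t => -(q 0 * Real.exp (-(M + 1) * t)))
      (-(q 0 * (Real.exp (-(M + 1) * t) * (-(M + 1) * 1)))) t := fun t =>
    ((((hasDerivAt_id t).const_mul (-(M + 1))).exp).const_mul (q 0)).neg
  have := image_le_of_deriv_right_lt_deriv_boundary' (f := fun t => -q t) (f' := fun t => -q' t)
    (B := fun t => -(q 0 * Real.exp (-(M + 1) * t)))
    (B' := fun t => -(q 0 * (Real.exp (-(M + 1) * t) * (-(M + 1) * 1))))
    hq.neg (fun t ht => (hq' t ht).neg) (by simp)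
    (fun t _ => (hB t).continuousAt.continuousWithinAt)
    (fun t _ => (hB t).hasDerivWithinAt) (fun t ht h => ?_) ht
  · simpa using this
  · have h1 : q t = q 0 * Real.exp (-(M + 1) * t) := by simpa using h
    have h2 : 0 < q t := by rw [h1]; positivity
    have h3 := hM t ht h2
    have h4 : -(q 0 * (Real.exp (-(M + 1) * t) * (-(M + 1) * 1))) = (M + 1) * q t := by
      rw [h1]; ring
    rw [h4]; linarith

/-- A globally Lipschitz and bounded autonomous field has solutions on every interval `[0, T]`. -/
lemma exists_solution_of_lipschitz_of_bounded {E : Type*} [NormedAddCommGroup E] [NormedSpace ℝ E]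
    [CompleteSpace E] {G : E → E} {K : NNReal} (hG : LipschitzWith K G) {L : ℝ}
    (hL : ∀ x, ‖G x‖ ≤ L) (x₀ : E) {T : ℝ} (hT : 0 ≤ T) :
    ∃ X : ℝ → E, X 0 = x₀ ∧ ∀ t ∈ Icc 0 T, HasDerivWithinAt X (G (X t)) (Icc 0 T) t := by
  have hL0 : 0 ≤ L := (norm_nonneg _).trans (hL x₀)
  have hpl : IsPicardLindelof (fun _ => G) (⟨0, left_mem_Icc.2 hT⟩ : Icc (0 : ℝ) T) x₀
      (⟨L * T, by positivity⟩ : NNReal) 0 ⟨L, hL0⟩ K :=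
    { lipschitzOnWith := fun _ _ => hG.lipschitzOnWith
      continuousOn := fun _ _ => continuousOn_const
      norm_le := fun _ _ x _ => hL x
      mul_max_le := by simp [hT]; exact le_rfl }
  exact hpl.exists_eq_forall_mem_Icc_hasDerivWithinAt₀

lemma IsTrajectoryOn.continuousOn {n : ℕ}
    {v : EuclideanSpace ℝ (Fin n) → EuclideanSpace ℝ (Fin n)} {K : Set (EuclideanSpace ℝ (Fin n))}
    {I : Set ℝ} {x : ℝ → EuclideanSpace ℝ (Fin n)} (h : IsTrajectoryOn v K I x) :
    ContinuousOn x I := fun t ht => (h t ht).2.continuousWithinAt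

lemma IsTrajectoryOn.mono {n : ℕ}
    {v : EuclideanSpace ℝ (Fin n) → EuclideanSpace ℝ (Fin n)} {K K' : Set (EuclideanSpace ℝ (Fin n))}
    {I J : Set ℝ} {x : ℝ → EuclideanSpace ℝ (Fin n)} (h : IsTrajectoryOn v K I x)
    (hK : K ⊆ K') (hJ : J ⊆ I) : IsTrajectoryOn v K' J x :=
  fun t ht => ⟨hK (h t (hJ ht)).1, (h t (hJ ht)).2.mono hJ⟩

lemma IsTrajectoryOn.hasDerivWithinAt_Ici {n : ℕ}
    {v : EuclideanSpace ℝ (Fin n) → EuclideanSpace ℝ (Fin n)} {K : Set (EuclideanSpace ℝ (Fin n))}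
    {a b : ℝ} {x : ℝ → EuclideanSpace ℝ (Fin n)} (h : IsTrajectoryOn v K (Icc a b) x)
    {t : ℝ} (ht : t ∈ Ico a b) : HasDerivWithinAt x (v (x t)) (Ici t) t :=
  (h t ⟨ht.1, ht.2.le⟩).2.mono_of_mem_nhdsWithin (Icc_mem_nhdsGE_of_mem ht)

/-- Uniqueness for trajectories that remain in a compact convex set on which the field is `C¹`. -/
lemma IsTrajectoryOn.eqOn {n : ℕ}
    {v : EuclideanSpace ℝ (Fin n) → EuclideanSpace ℝ (Fin n)} {K : Set (EuclideanSpace ℝ (Fin n))}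
    (hK : IsCompact K) (hKc : Convex ℝ K) (hv : ContDiffOn ℝ 1 v K) {T : ℝ}
    {x y : ℝ → EuclideanSpace ℝ (Fin n)} (hx : IsTrajectoryOn v K (Icc 0 T) x)
    (hy : IsTrajectoryOn v K (Icc 0 T) y) (h0 : x 0 = y 0) : EqOn x y (Icc 0 T) := by
  obtain ⟨C, hC⟩ := hv.exists_lipschitzOnWith one_ne_zero hKc hK
  exact ODE_solution_unique_of_mem_Icc_right (v := fun _ => v) (s := fun _ => K) (fun _ _ => hC)
    hx.continuousOn (fun t ht => hx.hasDerivWithinAt_Ici ht)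
    (fun t ht => (hx t ⟨ht.1, ht.2.le⟩).1)
    hy.continuousOn (fun t ht => hy.hasDerivWithinAt_Ici ht)
    (fun t ht => (hy t ⟨ht.1, ht.2.le⟩).1) h0

section Field

variable {n : ℕ} {α β : Fin n → ℕ} {c k : ℕ}
  {f F : EuclideanSpace ℝ (Fin n) → EuclideanSpace ℝ (Fin n)}

/-- A trajectory that starts off the horizon approaches it at most exponentially fast. The factor
`χ` allows for a cutoff of the field. -/
lemma defect_lower_bound (hα : ∀ i, 0 < α i) (hβ : ∀ i, 0 < β i) (hc : 0 < c)
    (hαβ : ∀ i, α i * β i = c) {M : ℝ}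
    (hM : ∀ x : EuclideanSpace ℝ (Fin n), pSum β x < 1 → |radial α β c k f F x| ≤ M)
    {x : ℝ → EuclideanSpace ℝ (Fin n)} {T : ℝ} {χ : EuclideanSpace ℝ (Fin n) → ℝ}
    (hχ : ∀ z, χ z ∈ Icc (0 : ℝ) 1)
    (hx : IsTrajectoryOn (fun z => χ z • desing α β c k f F z) univ (Icc 0 T) x)
    (h0 : pSum β (x 0) < 1) :
    ∀ t ∈ Icc 0 T, (1 - pSum β (x 0)) * Real.exp (-(M + 1) * t) ≤ 1 - pSum β (x t) := by
  refine mul_exp_le_of_deriv_ge (q := fun t => 1 - pSum β (x t))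
    (q' := fun t => -(χ (x t) * (radial α β c k f F (x t) * (1 - pSum β (x t)))))
    (continuousOn_const.sub (continuous_pSum.comp_continuousOn hx.continuousOn)) (fun t ht => ?_)
    (sub_pos.2 h0) fun t ht hq => ?_
  · have h := (hasDerivWithinAt_pSum (β := β) (hx.hasDerivWithinAt_Ici ht)).const_sub 1
    refine h.congr_deriv (congrArg Neg.neg ?_)
    rw [← sum_grad_mul_desing hα hβ hc hαβ, Finset.mul_sum]
    refine Finset.sum_congr rfl fun i _ => ?_
    simp only [PiLp.smul_apply, smul_eq_mul]
    ring
  · have h1 := hM (x t) (by linarith)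
    have h2 := hχ (x t)
    have h3 : χ (x t) * radial α β c k f F (x t) ≤ M := by
      calc _ ≤ χ (x t) * |radial α β c k f F (x t)| :=
            mul_le_mul_of_nonneg_left (le_abs_self _) h2.1
        _ ≤ 1 * |radial α β c k f F (x t)| := mul_le_mul_of_nonneg_right h2.2 (abs_nonneg _)
        _ ≤ M := by rw [one_mul]; exact h1
    nlinarith

lemma desing_defect_lower_bound (hα : ∀ i, 0 < α i) (hβ : ∀ i, 0 < β i) (hc : 0 < c)
    (hαβ : ∀ i, α i * β i = c) {M : ℝ}
    (hM : ∀ x : EuclideanSpace ℝ (Fin n), pSum β x < 1 → |radial α β c k f F x| ≤ M)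
    {x : ℝ → EuclideanSpace ℝ (Fin n)} {T : ℝ} {K : Set (EuclideanSpace ℝ (Fin n))}
    (hx : IsTrajectoryOn (desing α β c k f F) K (Icc 0 T) x) (h0 : pSum β (x 0) < 1) :
    ∀ t ∈ Icc 0 T, (1 - pSum β (x 0)) * Real.exp (-(M + 1) * t) ≤ 1 - pSum β (x t) :=
  defect_lower_bound hα hβ hc hαβ hM (χ := fun _ => 1) (fun _ => ⟨zero_le_one, le_rfl⟩)
    (by simpa using hx.mono (subset_univ _) Subset.rfl) h0

/-- The desingularized field, which need not be `C¹` at the horizon, can be cut off to a globally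
`C¹`, compactly supported one that is unchanged where `1 - ∑ xᵢ ^ (2 βᵢ) ≥ δ`. -/
lemma exists_cutoff (hβ : ∀ i, 0 < β i) (hc : 0 < c) (hf : ContDiff ℝ (⊤ : ℕ∞) f) {δ : ℝ}
    (hδ : 0 < δ) : ∃ χ : EuclideanSpace ℝ (Fin n) → ℝ, (∀ z, χ z ∈ Icc (0 : ℝ) 1) ∧
      (∀ z, δ ≤ 1 - pSum β z → χ z = 1) ∧
      ContDiff ℝ 1 (fun z => χ z • desing α β c k f F z) ∧
      HasCompactSupport (fun z => χ z • desing α β c k f F z) := by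
  set χ : EuclideanSpace ℝ (Fin n) → ℝ :=
    fun z => Real.smoothTransition ((2 * (1 - pSum β z) - δ) / δ) with hχdef
  have hχ : ContDiff ℝ 1 χ :=
    (Real.smoothTransition.contDiff (n := 1)).comp
      (((contDiff_const.mul (contDiff_const.sub contDiff_pSum)).sub contDiff_const).div_const _)
  have hzero : ∀ z, 1 - pSum β z ≤ δ / 2 → χ z = 0 := fun z hz =>
    Real.smoothTransition.zero_of_nonpos (div_nonpos_of_nonpos_of_nonneg (by linarith) hδ.le)
  refine ⟨χ, fun z => ⟨Real.smoothTransition.nonneg _, Real.smoothTransition.le_one _⟩,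
    fun z hz => Real.smoothTransition.one_of_one_le ?_, ?_, ?_⟩
  · rw [le_div_iff₀ hδ]; linarith
  · rw [contDiff_iff_contDiffAt]
    intro z
    rcases lt_or_ge (pSum β z) 1 with hz | hz
    · exact hχ.contDiffAt.smul ((contDiffOn_desing hc hf).contDiffAt
        ((isOpen_lt continuous_pSum continuous_const).mem_nhds hz))
    · refine (contDiffAt_const (c := (0 : EuclideanSpace ℝ (Fin n)))).congr_of_eventuallyEq ?_
      have hU : {w | 1 - δ / 2 < pSum β w} ∈ 𝓝 z :=
        (isOpen_lt continuous_const continuous_pSum).mem_nhds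
          (show 1 - δ / 2 < pSum β z by linarith)
      filter_upwards [hU] with w hw
      have hw' : 1 - δ / 2 < pSum β w := hw
      rw [hzero w (by linarith), zero_smul]
  · refine HasCompactSupport.intro (isCompact_pSum_le hβ le_rfl) fun z hz => ?_
    have hz' : 1 < pSum β z := not_le.1 hz
    rw [hzero z (by linarith), zero_smul]

/-- Two trajectories of the desingularized field that start at the same point off the horizon
coincide. -/
lemma desing_eqOn (hα : ∀ i, 0 < α i) (hβ : ∀ i, 0 < β i) (hc : 0 < c)
    (hαβ : ∀ i, α i * β i = c) (hf : IsAsymptoticallyQuasiHomogeneous α k f F)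
    {x y : ℝ → EuclideanSpace ℝ (Fin n)} {T : ℝ} {K K' : Set (EuclideanSpace ℝ (Fin n))}
    (hx : IsTrajectoryOn (desing α β c k f F) K (Icc 0 T) x)
    (hy : IsTrajectoryOn (desing α β c k f F) K' (Icc 0 T) y)
    (h0 : pSum β (x 0) < 1) (hxy : x 0 = y 0) : EqOn x y (Icc 0 T) := by
  obtain ⟨M, hM0, hM⟩ := exists_radial_bound hα hβ hc hαβ hf
  have hpos : 0 < 1 - pSum β (x 0) := sub_pos.2 h0
  set δ := (1 - pSum β (x 0)) * Real.exp (-(M + 1) * T) with hδ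
  have hδ0 : 0 < δ := by positivity
  have key : ∀ (z : ℝ → EuclideanSpace ℝ (Fin n)) (K'' : Set (EuclideanSpace ℝ (Fin n))),
      z 0 = x 0 → IsTrajectoryOn (desing α β c k f F) K'' (Icc 0 T) z →
      IsTrajectoryOn (desing α β c k f F) {z | pSum β z ≤ 1 - δ} (Icc 0 T) z := by
    intro z K'' hz0 hz t ht
    refine ⟨?_, (hz t ht).2⟩
    have h1 := desing_defect_lower_bound hα hβ hc hαβ hM hz (by rw [hz0]; exact h0) t ht
    have h2 : δ ≤ (1 - pSum β (z 0)) * Real.exp (-(M + 1) * t) := by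
      rw [hz0, hδ]
      refine mul_le_mul_of_nonneg_left (Real.exp_le_exp.2 ?_) hpos.le
      nlinarith [ht.2]
    show pSum β (z t) ≤ 1 - δ
    linarith
  refine (key x K rfl hx).eqOn (isCompact_pSum_le hβ (by linarith)) (convex_pSum_le _)
    ((contDiffOn_desing hc hf.1).mono fun z (hz : pSum β z ≤ 1 - δ) => ?_)
    (key y K' hxy.symm hy) hxy
  show pSum β z < 1
  linarith

/-- Off the horizon, the desingularized field is forward complete. -/
lemma exists_global_trajectory (hα : ∀ i, 0 < α i) (hβ : ∀ i, 0 < β i) (hc : 0 < c)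
    (hαβ : ∀ i, α i * β i = c) (hf : IsAsymptoticallyQuasiHomogeneous α k f F)
    {x₀ : EuclideanSpace ℝ (Fin n)} (h0 : pSum β x₀ < 1) :
    ∃ X : ℝ → EuclideanSpace ℝ (Fin n), X 0 = x₀ ∧
      IsTrajectoryOn (desing α β c k f F) (domain β c) (Ici 0) X := by
  obtain ⟨M, hM0, hM⟩ := exists_radial_bound hα hβ hc hαβ hf
  have hpos : 0 < 1 - pSum β x₀ := sub_pos.2 h0
  have hfin : ∀ T : ℝ, 0 ≤ T → ∃ X : ℝ → EuclideanSpace ℝ (Fin n), X 0 = x₀ ∧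
      IsTrajectoryOn (desing α β c k f F) (domain β c) (Icc 0 T) X := by
    intro T hT
    have hδ0 : 0 < (1 - pSum β x₀) * Real.exp (-(M + 1) * T) := by positivity
    obtain ⟨χ, hχ, hχ1, hsm, hcs⟩ := exists_cutoff (α := α) (k := k) (F := F) hβ hc hf.1 hδ0
    obtain ⟨C, hC⟩ := hsm.lipschitzWith_of_hasCompactSupport hcs one_ne_zero
    obtain ⟨L, hL⟩ := hcs.exists_bound_of_continuous hsm.continuous
    obtain ⟨X, hX0, hX⟩ := exists_solution_of_lipschitz_of_bounded hC hL x₀ hT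
    have hXt : IsTrajectoryOn (fun z => χ z • desing α β c k f F z) univ (Icc 0 T) X :=
      fun t ht => ⟨mem_univ _, hX t ht⟩
    refine ⟨X, hX0, fun t ht => ?_⟩
    have h1 := defect_lower_bound hα hβ hc hαβ hM hχ hXt (by rw [hX0]; exact h0) t ht
    have h2 : (1 - pSum β x₀) * Real.exp (-(M + 1) * T) ≤ 1 - pSum β (X t) := by
      refine le_trans ?_ h1
      rw [hX0]
      refine mul_le_mul_of_nonneg_left (Real.exp_le_exp.2 ?_) hpos.le
      nlinarith [ht.2]
    refine ⟨(mem_domain_iff hc).2 (by linarith), ?_⟩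
    have h3 := hX t ht
    simpa only [hχ1 _ h2, one_smul] using h3
  choose! Y hY0 hY using hfin
  have hagree : ∀ S T : ℝ, 0 ≤ S → S ≤ T → EqOn (Y S) (Y T) (Icc 0 S) := fun S T hS hST =>
    desing_eqOn hα hβ hc hαβ hf (hY S hS)
      ((hY T (hS.trans hST)).mono Subset.rfl (Icc_subset_Icc_right hST))
      (by rw [hY0 S hS]; exact h0) (by rw [hY0 S hS, hY0 T (hS.trans hST)])
  refine ⟨fun t => Y t t, hY0 0 le_rfl, fun t (ht : 0 ≤ t) => ?_⟩
  have hmem : Icc 0 (t + 1) ∈ 𝓝[Ici 0] t := by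
    rw [← Ici_inter_Iic]
    exact inter_mem self_mem_nhdsWithin (mem_nhdsWithin_of_mem_nhds (Iic_mem_nhds (by linarith)))
  have h1 := hY (t + 1) (by linarith) t ⟨ht, by linarith⟩
  have heq : ∀ s ∈ Icc 0 (t + 1), Y s s = Y (t + 1) s := fun s hs =>
    hagree s (t + 1) hs.1 hs.2 ⟨hs.1, le_rfl⟩
  have ht' := heq t ⟨ht, by linarith⟩
  refine ⟨by simpa only [ht'] using h1.1, ?_⟩
  have h2 : HasDerivWithinAt (fun s => Y s s) (desing α β c k f F (Y t t)) (Icc 0 (t + 1)) t := by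
    rw [ht']
    exact h1.2.congr heq ht'
  exact h2.mono_of_mem_nhdsWithin hmem

end Field

/-! ### Quadratic Lyapunov functions -/

section Lyapunov

variable {n : ℕ} {M Y : Matrix (Fin n) (Fin n) ℝ}

/-- The bilinear form `vᵀ M w`. -/
noncomputable def bil (M : Matrix (Fin n) (Fin n) ℝ) (v w : EuclideanSpace ℝ (Fin n)) : ℝ :=
  ∑ i, ∑ j, v i * M i j * w j

lemma quad_eq_bil (v : EuclideanSpace ℝ (Fin n)) : quad M v = bil M v v := rfl

lemma bil_eq_dotProduct (v w : EuclideanSpace ℝ (Fin n)) :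
    bil M v w = v.ofLp ⬝ᵥ M.mulVec w.ofLp := by
  simp [bil, dotProduct, Matrix.mulVec, Finset.mul_sum, mul_assoc]

lemma bil_comm (hM : M.IsSymm) (v w : EuclideanSpace ℝ (Fin n)) : bil M v w = bil M w v := by
  rw [bil, Finset.sum_comm]
  refine Finset.sum_congr rfl fun j _ => Finset.sum_congr rfl fun i _ => ?_
  rw [← hM.apply i j]; ring

lemma bil_zero_right (v : EuclideanSpace ℝ (Fin n)) : bil M v 0 = 0 := by simp [bil]

lemma bil_zero_left (w : EuclideanSpace ℝ (Fin n)) : bil M 0 w = 0 := by simp [bil]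

lemma quad_smul (s : ℝ) (v : EuclideanSpace ℝ (Fin n)) : quad M (s • v) = s ^ 2 * quad M v := by
  simp only [quad, Finset.mul_sum, PiLp.smul_apply, smul_eq_mul]
  exact Finset.sum_congr rfl fun i _ => Finset.sum_congr rfl fun j _ => by ring

lemma contDiff_quad {m : WithTop ℕ∞} : ContDiff ℝ m (quad M) := by
  unfold quad; fun_prop

lemma continuous_quad : Continuous (quad M) := (contDiff_quad (m := 0)).continuous

lemma hasDerivWithinAt_bil {x y : ℝ → EuclideanSpace ℝ (Fin n)} {v w : EuclideanSpace ℝ (Fin n)}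
    {s : Set ℝ} {t : ℝ} (hx : HasDerivWithinAt x v s t) (hy : HasDerivWithinAt y w s t) :
    HasDerivWithinAt (fun τ => bil M (x τ) (y τ)) (bil M v (y t) + bil M (x t) w) s t := by
  simp only [bil, ← Finset.sum_add_distrib]
  exact HasDerivWithinAt.fun_sum fun i _ => HasDerivWithinAt.fun_sum fun j _ =>
    ((hasDerivWithinAt_euclidean.1 hx i).mul_const _).mul (hasDerivWithinAt_euclidean.1 hy j)

lemma hasDerivWithinAt_quad (hM : M.IsSymm) {x : ℝ → EuclideanSpace ℝ (Fin n)}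
    {v a : EuclideanSpace ℝ (Fin n)} {s : Set ℝ} {t : ℝ} (hx : HasDerivWithinAt x v s t) :
    HasDerivWithinAt (fun τ => quad M (x τ - a)) (2 * bil M (x t - a) v) s t := by
  refine (hasDerivWithinAt_bil (hx.sub_const a) (hx.sub_const a)).congr_deriv ?_
  rw [bil_comm hM v]; ring

lemma quad_pos (hY : Y.PosDef) {v : EuclideanSpace ℝ (Fin n)} (hv : v ≠ 0) : 0 < quad Y v := by
  have h := hY.dotProduct_mulVec_pos (x := v.ofLp)
    (fun h => hv (by ext i; simpa using congrFun h i))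
  rwa [star_trivial, ← bil_eq_dotProduct] at h

lemma quad_nonneg (hY : Y.PosDef) (v : EuclideanSpace ℝ (Fin n)) : 0 ≤ quad Y v := by
  rcases eq_or_ne v 0 with rfl | hv
  · exact (bil_zero_right _).ge
  · exact (quad_pos hY hv).le

lemma exists_mul_sq_norm_le_quad (hY : Y.PosDef) :
    ∃ m : ℝ, 0 < m ∧ ∀ v, m * ‖v‖ ^ 2 ≤ quad Y v := by
  obtain ⟨m, hm0, hm⟩ := (isCompact_sphere (0 : EuclideanSpace ℝ (Fin n)) 1).exists_forall_le'
    (f := quad Y) continuous_quad.continuousOn (a := 0)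
    fun u hu => quad_pos hY (by rintro rfl; simp at hu)
  refine ⟨m, hm0, fun v => ?_⟩
  rcases eq_or_ne v 0 with rfl | hv
  · simp [quad]
  · have hv' : ‖v‖ ≠ 0 := norm_ne_zero_iff.2 hv
    have h1 := hm (‖v‖⁻¹ • v) (by simp [norm_smul, hv'])
    rw [quad_smul, inv_pow, le_inv_mul_iff₀ (by positivity)] at h1
    linarith

lemma isSymm_of_posDef (hY : Y.PosDef) : Y.IsSymm := by
  have h := hY.isHermitian
  rwa [Matrix.IsHermitian, Matrix.conjTranspose_eq_transpose_of_trivial] at h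

lemma quad_lyapMatrix (hY : Y.IsSymm)
    (g : EuclideanSpace ℝ (Fin n) → EuclideanSpace ℝ (Fin n)) (K : Set (EuclideanSpace ℝ (Fin n)))
    (z w : EuclideanSpace ℝ (Fin n)) :
    quad (lyapMatrix g K Y z) w = 2 * bil Y w (fderivWithin ℝ g K z w) := by
  have h1 : (jacobian g K z).mulVec w.ofLp = (fderivWithin ℝ g K z w).ofLp := by
    funext i
    have hw : w = ∑ j, w j • EuclideanSpace.single j (1 : ℝ) := by
      ext l; simp [Finset.sum_apply, Pi.single_apply]
    conv_rhs => rw [hw, map_sum]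
    simp [Matrix.mulVec, dotProduct, jacobian, mul_comm]
  rw [quad_eq_bil, bil_eq_dotProduct, lyapMatrix, Matrix.add_mulVec, dotProduct_add,
    ← Matrix.mulVec_mulVec, ← Matrix.mulVec_mulVec, h1, Matrix.dotProduct_mulVec,
    Matrix.vecMul_transpose, h1, ← bil_eq_dotProduct, ← bil_eq_dotProduct, bil_comm hY]
  ring

/-- The mean value theorem on the segment from the equilibrium turns the matrix inequality for
`A(x)` into a differential inequality for the Lyapunov function. -/
lemma two_mul_bil_le (hY : Y.PosDef)
    {g : EuclideanSpace ℝ (Fin n) → EuclideanSpace ℝ (Fin n)} {K Nt : Set (EuclideanSpace ℝ (Fin n))}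
    {xs : EuclideanSpace ℝ (Fin n)} (hK : Convex ℝ K) (hxs : xs ∈ K) (hg : g xs = 0) {ε r : ℝ}
    (hN : {x ∈ K | quad Y (x - xs) ≤ ε} ⊆ Nt)
    (hneg : ∀ x ∈ Nt, (-(lyapMatrix g K Y x)).PosDef)
    (hA : ∀ z ∈ Nt, ∀ v, quad (lyapMatrix g K Y z) v ≤ -r * quad Y v)
    {z : EuclideanSpace ℝ (Fin n)} (hz : z ∈ K) (hzε : quad Y (z - xs) ≤ ε) :
    2 * bil Y (z - xs) (g z) ≤ -r * quad Y (z - xs) := by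
  rcases eq_or_ne z xs with rfl | hne
  · simp [hg, bil, quad]
  set w := z - xs with hw
  have hw0 : w ≠ 0 := sub_ne_zero.2 hne
  have hmap : ∀ s ∈ Icc (0 : ℝ) 1, xs + s • w ∈ K := fun s hs =>
    hK.add_smul_sub_mem hxs hz hs
  have hmem : ∀ s ∈ Icc (0 : ℝ) 1, xs + s • w ∈ Nt := fun s hs => by
    refine hN ⟨hmap s hs, ?_⟩
    rw [add_sub_cancel_left, quad_smul]
    exact (mul_le_of_le_one_left (quad_nonneg hY w) (pow_le_one₀ hs.1 hs.2)).trans hzε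
  have hdiff : ∀ s ∈ Icc (0 : ℝ) 1, DifferentiableWithinAt ℝ g K (xs + s • w) := by
    intro s hs
    -- Where `g` is not differentiable, `fderivWithin` is zero, hence so is the Lyapunov matrix.
    by_contra hnd
    have h1 := quad_pos (hneg _ (hmem s hs)) hw0
    have h2 : quad (-(lyapMatrix g K Y (xs + s • w))) w = -quad (lyapMatrix g K Y (xs + s • w)) w := by
      simp [quad]
    rw [h2, quad_lyapMatrix (isSymm_of_posDef hY),
      fderivWithin_zero_of_not_differentiableWithinAt hnd] at h1
    simp [bil] at h1
  have hder : ∀ s ∈ Icc (0 : ℝ) 1, HasDerivWithinAt (fun s : ℝ => bil Y w (g (xs + s • w)))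
      (bil Y w (fderivWithin ℝ g K (xs + s • w) w)) (Icc 0 1) s := by
    intro s hs
    have h1 : HasDerivWithinAt (fun s : ℝ => xs + s • w) w (Icc 0 1) s := by
      simpa using (((hasDerivAt_id s).smul_const w).const_add xs).hasDerivWithinAt
    have h2 := (hdiff s hs).hasFDerivWithinAt.comp_hasDerivWithinAt s h1 hmap
    have h3 := hasDerivWithinAt_bil (M := Y) (hasDerivWithinAt_const s (Icc (0 : ℝ) 1) w) h2
    simpa [bil_zero_left] using h3
  obtain ⟨s, hs, hs'⟩ := exists_hasDerivAt_eq_slope (fun s : ℝ => bil Y w (g (xs + s • w)))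
    (fun s => bil Y w (fderivWithin ℝ g K (xs + s • w) w)) zero_lt_one
    (fun s hs => (hder s hs).continuousWithinAt)
    (fun s hs => (hder s (Ioo_subset_Icc_self hs)).hasDerivAt (Icc_mem_nhds hs.1 hs.2))
  have h1 := hA _ (hmem s (Ioo_subset_Icc_self hs)) w
  rw [quad_lyapMatrix (isSymm_of_posDef hY), hs'] at h1
  simpa [hg, bil_zero_right, hw] using h1

/-- If `ℓ' ≤ -r ℓ` wherever `ℓ ≤ ε`, then the sublevel set `{ℓ ≤ ε}` is invariant and `ℓ` decays
exponentially in it. -/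
lemma le_mul_exp_of_deriv_le {ℓ ℓ' : ℝ → ℝ} {T ε r : ℝ} (hε : 0 < ε) (hr : 0 < r)
    (hc : ContinuousOn ℓ (Icc 0 T)) (hd : ∀ t ∈ Ico 0 T, HasDerivWithinAt ℓ (ℓ' t) (Ici t) t)
    (h0 : ℓ 0 ≤ ε) (hle : ∀ t ∈ Ico 0 T, ℓ t ≤ ε → ℓ' t ≤ -r * ℓ t) :
    ∀ t ∈ Icc 0 T, ℓ t ≤ ε ∧ ℓ t ≤ ℓ 0 * Real.exp (-r * t) := by
  have h1 : ∀ t ∈ Icc 0 T, ℓ t ≤ ε := fun _ ht =>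
    image_le_of_deriv_right_lt_deriv_boundary' hc hd (B := fun _ => ε) (B' := fun _ => 0) h0
      continuousOn_const (fun _ _ => hasDerivWithinAt_const _ _ _)
      (fun t ht h => by have := hle t ht h.le; rw [h] at this; nlinarith) ht
  refine fun t ht => ⟨h1 t ht, ?_⟩
  have hexp : ∀ t : ℝ, HasDerivAt (fun t => Real.exp (r * t)) (Real.exp (r * t) * (r * 1)) t :=
    fun t => ((hasDerivAt_id t).const_mul r).exp
  have h2 := image_le_of_deriv_right_le_deriv_boundary (f := fun t => ℓ t * Real.exp (r * t))
    (B := fun _ => ℓ 0) (B' := fun _ => 0)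
    (hc.mul (by fun_prop)) (fun t ht => (hd t ht).mul (hexp t).hasDerivWithinAt) (by simp)
    continuousOn_const (fun _ _ => hasDerivWithinAt_const _ _ _) (fun t ht => ?_) ht
  · rw [neg_mul, Real.exp_neg, ← div_eq_mul_inv, le_div_iff₀ (Real.exp_pos _)]
    exact h2
  · have h3 := hle t ht (h1 t ⟨ht.1, ht.2.le⟩)
    have h4 := Real.exp_pos (r * t)
    nlinarith

section Decay

variable {g : EuclideanSpace ℝ (Fin n) → EuclideanSpace ℝ (Fin n)}
  {K : Set (EuclideanSpace ℝ (Fin n))} {xs : EuclideanSpace ℝ (Fin n)} {ε r : ℝ}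

lemma quad_le_mul_exp (hY : Y.PosDef) (hε : 0 < ε) (hr : 0 < r)
    (hdec : ∀ z ∈ K, quad Y (z - xs) ≤ ε → 2 * bil Y (z - xs) (g z) ≤ -r * quad Y (z - xs))
    {T : ℝ} {x : ℝ → EuclideanSpace ℝ (Fin n)} (hx : IsTrajectoryOn g K (Icc 0 T) x)
    (h0 : quad Y (x 0 - xs) ≤ ε) :
    ∀ t ∈ Icc 0 T, quad Y (x t - xs) ≤ ε ∧
      quad Y (x t - xs) ≤ quad Y (x 0 - xs) * Real.exp (-r * t) :=
  le_mul_exp_of_deriv_le (ℓ := fun t => quad Y (x t - xs)) hε hr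
    (continuous_quad.comp_continuousOn (hx.continuousOn.sub continuousOn_const))
    (fun _ ht => hasDerivWithinAt_quad (isSymm_of_posDef hY) (hx.hasDerivWithinAt_Ici ht)) h0
    (fun t ht => hdec (x t) (hx t ⟨ht.1, ht.2.le⟩).1)

lemma tendsto_of_quad_le (hY : Y.PosDef) (hε : 0 < ε) (hr : 0 < r)
    (hdec : ∀ z ∈ K, quad Y (z - xs) ≤ ε → 2 * bil Y (z - xs) (g z) ≤ -r * quad Y (z - xs))
    {x : ℝ → EuclideanSpace ℝ (Fin n)} (hx : IsTrajectoryOn g K (Ici 0) x)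
    (h0 : quad Y (x 0 - xs) ≤ ε) : Tendsto x atTop (𝓝 xs) := by
  obtain ⟨m, hm0, hm⟩ := exists_mul_sq_norm_le_quad hY
  have h1 : ∀ t, 0 ≤ t → ‖x t - xs‖ ^ 2 ≤ m⁻¹ * (quad Y (x 0 - xs) * Real.exp (-r * t)) := by
    intro t ht
    rw [le_inv_mul_iff₀ hm0]
    exact (hm _).trans (quad_le_mul_exp hY hε hr hdec (hx.mono Subset.rfl Icc_subset_Ici_self) h0 t
      ⟨ht, le_rfl⟩).2
  have h2 : Tendsto (fun t : ℝ => m⁻¹ * (quad Y (x 0 - xs) * Real.exp (-r * t))) atTop (𝓝 0) := by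
    have h3 : Tendsto (fun t : ℝ => -r * t) atTop atBot :=
      tendsto_id.const_mul_atTop_of_neg (by linarith)
    simpa using ((Real.tendsto_exp_atBot.comp h3).const_mul (quad Y (x 0 - xs))).const_mul m⁻¹
  have h4 : Tendsto (fun t => ‖x t - xs‖ ^ 2) atTop (𝓝 0) :=
    squeeze_zero' (Eventually.of_forall fun t => by positivity)
      ((eventually_ge_atTop 0).mono h1) h2
  have h5 : Tendsto (fun t => √(‖x t - xs‖ ^ 2)) atTop (𝓝 √0) := h4.sqrt
  simp only [Real.sqrt_sq (norm_nonneg _), Real.sqrt_zero] at h5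
  exact tendsto_iff_norm_sub_tendsto_zero.2 h5

lemma isAsymptoticallyStable_of_decay (hY : Y.PosDef) (hε : 0 < ε) (hr : 0 < r) (hg : g xs = 0)
    (hdec : ∀ z ∈ K, quad Y (z - xs) ≤ ε → 2 * bil Y (z - xs) (g z) ≤ -r * quad Y (z - xs)) :
    IsAsymptoticallyStable g K xs := by
  obtain ⟨m, hm0, hm⟩ := exists_mul_sq_norm_le_quad hY
  have hnear : ∀ η > 0, ∃ δ > 0, ∀ z, ‖z - xs‖ < δ → quad Y (z - xs) < η := by
    intro η hη
    have h1 : Tendsto (quad Y) (𝓝 0) (𝓝 0) := by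
      simpa [quad] using (continuous_quad (M := Y)).tendsto 0
    obtain ⟨δ, hδ, h⟩ := Metric.eventually_nhds_iff.1 (h1.eventually (Iio_mem_nhds hη))
    exact ⟨δ, hδ, fun z hz => h (by simpa using hz)⟩
  refine ⟨hg, fun ρ hρ => ?_, ?_⟩
  · -- below the level `m ρ² / 2` the Lyapunov function confines trajectories to the `ρ`-ball
    set η := min ε (m * ρ ^ 2 / 2) with hη
    have hη0 : 0 < η := lt_min hε (by positivity)
    obtain ⟨δ, hδ, hδη⟩ := hnear η hη0
    refine ⟨δ, hδ, fun b x hx hx0 τ hτ => ?_⟩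
    have h1 := (quad_le_mul_exp hY hη0 hr
      (fun z hz h => hdec z hz (h.trans (min_le_left _ _)))
      (hx.mono Subset.rfl (Icc_subset_Ico_right hτ.2)) (hδη _ hx0).le τ ⟨hτ.1, le_rfl⟩).1
    have h2 := (hm (x τ - xs)).trans (h1.trans (min_le_right _ _))
    refine lt_of_pow_lt_pow_left₀ 2 hρ.le ?_
    have h3 : 0 < ρ ^ 2 := by positivity
    nlinarith
  · obtain ⟨δ, hδ, hδη⟩ := hnear ε hε
    exact ⟨δ, hδ, fun x hx hx0 => tendsto_of_quad_le hY hε hr hdec hx (hδη _ hx0).le⟩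

end Decay

end Lyapunov

/-! ### The remaining time near the equilibrium -/

section Horizon

variable {n : ℕ} {α β : Fin n → ℕ} {c k : ℕ}
  {f F : EuclideanSpace ℝ (Fin n) → EuclideanSpace ℝ (Fin n)}
  {Y : Matrix (Fin n) (Fin n) ℝ} {xs : EuclideanSpace ℝ (Fin n)} {ε r : ℝ}

lemma hasDerivWithinAt_add_smul (q v : EuclideanSpace ℝ (Fin n)) :
    HasDerivWithinAt (fun s : ℝ => q + s • v) v univ 0 := by
  simpa using ((hasDerivAt_id (0 : ℝ)).smul_const v).const_add q

lemma fderiv_pSum_apply (q v : EuclideanSpace ℝ (Fin n)) :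
    fderiv ℝ (pSum β) q v = ∑ i, (2 * β i : ℕ) * q i ^ (2 * β i - 1) * v i := by
  have h1 := hasDerivWithinAt_pSum (β := β) (hasDerivWithinAt_add_smul q v)
  have h2 : HasFDerivAt (pSum β) (fderiv ℝ (pSum β) q) (q + (0 : ℝ) • v) := by
    simpa using ((contDiff_pSum (m := 1)).differentiable one_ne_zero q).hasFDerivAt
  have h3 := h2.comp_hasDerivAt (0 : ℝ) (hasDerivWithinAt_univ.1 (hasDerivWithinAt_add_smul q v))
  simpa using h3.unique (hasDerivWithinAt_univ.1 h1)

lemma fderiv_quad_sub_apply (hY : Y.IsSymm) (q v : EuclideanSpace ℝ (Fin n)) :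
    fderiv ℝ (fun z => quad Y (z - xs)) q v = 2 * bil Y (q - xs) v := by
  have h1 := hasDerivWithinAt_quad (a := xs) hY (hasDerivWithinAt_add_smul q v)
  have hsm : ContDiff ℝ 1 fun z => quad Y (z - xs) :=
    contDiff_quad.comp (contDiff_id.sub contDiff_const)
  have h2 : HasFDerivAt (fun z => quad Y (z - xs)) (fderiv ℝ (fun z => quad Y (z - xs)) q)
      (q + (0 : ℝ) • v) := by
    simpa using (hsm.differentiable one_ne_zero q).hasFDerivAt
  have h3 := h2.comp_hasDerivAt (0 : ℝ) (hasDerivWithinAt_univ.1 (hasDerivWithinAt_add_smul q v))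
  simpa using h3.unique (hasDerivWithinAt_univ.1 h1)

/-- A sublevel set on which the Lyapunov function decreases cannot contain the horizon: the field
is tangent to the horizon, so the Lyapunov function does not decrease where its restriction to the
horizon is largest. -/
lemma exists_lt_quad_of_decay (hα : ∀ i, 0 < α i) (hβ : ∀ i, 0 < β i) (hc : 0 < c)
    (hαβ : ∀ i, α i * β i = c) (hY : Y.PosDef) (hr : 0 < r) (hxs : pSum β xs = 1)
    (hdec : ∀ z, pSum β z ≤ 1 → quad Y (z - xs) ≤ ε →
      2 * bil Y (z - xs) (desing α β c k f F z) ≤ -r * quad Y (z - xs)) :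
    ∃ z, pSum β z = 1 ∧ ε < quad Y (z - xs) := by
  by_contra! hle
  have hcomp : IsCompact {z | pSum β z = 1} :=
    (isCompact_pSum_le hβ le_rfl).of_isClosed_subset
      (isClosed_eq continuous_pSum continuous_const) fun z hz => le_of_eq hz
  have hsm : ContDiff ℝ 1 fun z => quad Y (z - xs) :=
    contDiff_quad.comp (contDiff_id.sub contDiff_const)
  obtain ⟨q, hq, hmax⟩ := hcomp.exists_isMaxOn ⟨xs, hxs⟩ hsm.continuous.continuousOn
  have hq1 : pSum β q = 1 := hq
  have hext : IsLocalExtrOn (fun z => quad Y (z - xs)) {z | pSum β z = pSum β q} q := by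
    rw [hq1]; exact Or.inr hmax.localize
  obtain ⟨a, b, hab, hsum⟩ := hext.exists_multipliers_of_hasStrictFDerivAt_1d
    ((contDiff_pSum (m := 1)).contDiffAt.hasStrictFDerivAt one_ne_zero)
    (hsm.contDiffAt.hasStrictFDerivAt one_ne_zero)
  have happ : ∀ v, a * (∑ i, (2 * β i : ℕ) * q i ^ (2 * β i - 1) * v i)
      + b * (2 * bil Y (q - xs) v) = 0 := fun v => by
    have := DFunLike.congr_fun hsum v
    simpa only [_root_.add_apply, _root_.smul_apply, smul_eq_mul,
      fderiv_pSum_apply, fderiv_quad_sub_apply (isSymm_of_posDef hY),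
      _root_.zero_apply] using this
  have hb : b ≠ 0 := by
    rintro rfl
    have ha : a ≠ 0 := by rintro rfl; exact hab rfl
    have h1 := happ q
    rw [zero_mul, add_zero, mul_eq_zero, or_iff_right ha] at h1
    have h2 : pSum β q ≤ ∑ i, (2 * β i : ℕ) * q i ^ (2 * β i - 1) * q i := by
      refine Finset.sum_le_sum fun i _ => ?_
      have h3 : q i ^ (2 * β i) = q i ^ (2 * β i - 1) * q i := by
        rw [← pow_succ]; congr 1; have := hβ i; omega
      have h4 : 0 ≤ q i ^ (2 * β i) := by rw [pow_mul]; positivity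
      have h5 : (1 : ℝ) ≤ (2 * β i : ℕ) := by exact_mod_cast (by have := hβ i; omega)
      rw [mul_assoc, ← h3]
      exact le_mul_of_one_le_left h4 h5
    linarith
  have h1 := happ (desing α β c k f F q)
  rw [sum_grad_mul_desing hα hβ hc hαβ, hq1, sub_self, mul_zero, mul_zero, zero_add, mul_eq_zero,
    or_iff_right hb] at h1
  have h2 := hdec q hq1.le (hle q hq1)
  have h3 : quad Y (q - xs) ≤ 0 := by nlinarith
  have hneg : pSum β (-xs) = 1 := by
    rw [← hxs]
    exact Finset.sum_congr rfl fun i _ => by simp [(even_two_mul (β i)).neg_pow]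
  have h4 : quad Y (-xs - xs) ≤ 0 := (hmax hneg).trans h3
  have h5 : -xs - xs = 0 := by
    by_contra h
    exact absurd (quad_pos hY h) (not_lt.2 h4)
  have h6 : xs = 0 := by
    have h7 : (-2 : ℝ) • xs = 0 := by rw [← h5]; module
    exact (smul_eq_zero.1 h7).resolve_left (by norm_num)
  rw [h6] at hxs
  simp [pSum, (hβ _).ne'] at hxs

/-- The Lyapunov function takes every value of `[0, ε]` on the phase space. -/
lemma exists_quad_eq (hα : ∀ i, 0 < α i) (hβ : ∀ i, 0 < β i) (hc : 0 < c)
    (hαβ : ∀ i, α i * β i = c) (hY : Y.PosDef) (hr : 0 < r) (hxs : pSum β xs = 1)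
    (hdec : ∀ z, pSum β z ≤ 1 → quad Y (z - xs) ≤ ε →
      2 * bil Y (z - xs) (desing α β c k f F z) ≤ -r * quad Y (z - xs))
    {ℓ : ℝ} (h0 : 0 ≤ ℓ) (hℓ : ℓ ≤ ε) : ∃ z, pSum β z ≤ 1 ∧ quad Y (z - xs) = ℓ := by
  obtain ⟨q, hq, hqε⟩ := exists_lt_quad_of_decay hα hβ hc hαβ hY hr hxs hdec
  have hpos : 0 < quad Y (q - xs) := by linarith
  have hs1 : √(ℓ / quad Y (q - xs)) ≤ 1 := by
    rw [Real.sqrt_le_one, div_le_one hpos]; linarith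
  refine ⟨xs + √(ℓ / quad Y (q - xs)) • (q - xs), ?_, ?_⟩
  · exact (convex_pSum_le (β := β) 1).add_smul_sub_mem hxs.le hq.le ⟨Real.sqrt_nonneg _, hs1⟩
  · rw [add_sub_cancel_left, quad_smul, Real.sq_sqrt (by positivity), div_mul_cancel₀ _ hpos.ne']

lemma timeFactor_pos (hc : 0 < c) (x : EuclideanSpace ℝ (Fin n)) :
    0 < timeFactor β c x := by
  rw [timeFactor_eq hc]
  have h0 := pSum_nonneg (β := β) x
  have hc' : (1 : ℝ) ≤ c := by exact_mod_cast hc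
  have h1 : (2 * (c : ℝ) - 1) / (2 * (c : ℝ)) < 1 := by rw [div_lt_one (by linarith)]; linarith
  have h2 : 0 ≤ (2 * (c : ℝ) - 1) / (2 * (c : ℝ)) := div_nonneg (by linarith) (by linarith)
  nlinarith

lemma timeFactor_le_one (hc : 0 < c) {x : EuclideanSpace ℝ (Fin n)} (hx : pSum β x ≤ 1) :
    timeFactor β c x ≤ 1 := by
  rw [timeFactor_eq hc]
  have hc' : (1 : ℝ) ≤ c := by exact_mod_cast hc
  have h2 : 0 ≤ (2 * (c : ℝ) - 1) / (2 * (c : ℝ)) := div_nonneg (by linarith) (by linarith)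
  nlinarith

lemma timeDensity_eq (hc : 0 < c) (x : EuclideanSpace ℝ (Fin n)) :
    timeDensity β c k x = timeFactor β c x * (1 - pSum β x) ^ k := by
  rw [timeDensity, p_pow hc]

lemma timeDensity_pos (hc : 0 < c) {x : EuclideanSpace ℝ (Fin n)} (hx : pSum β x < 1) :
    0 < timeDensity β c k x := by
  rw [timeDensity_eq hc]
  exact mul_pos (timeFactor_pos hc x) (pow_pos (sub_pos.2 hx) _)

lemma timeDensity_le (hc : 0 < c) {x : EuclideanSpace ℝ (Fin n)} (hx : pSum β x ≤ 1) :
    timeDensity β c k x ≤ (1 - pSum β x) ^ k := by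
  rw [timeDensity_eq hc]
  exact mul_le_of_le_one_left (pow_nonneg (by linarith) _) (timeFactor_le_one hc hx)

lemma continuous_timeDensity (hc : 0 < c) :
    Continuous (fun x : EuclideanSpace ℝ (Fin n) => timeDensity β c k x) := by
  simp only [timeDensity_eq hc, timeFactor_eq hc]
  have := continuous_pSum (β := β)
  fun_prop

end Horizon

/-- A time integral along which `ℓ` decays at rate `r` is bounded by an integral in the variable
`ℓ`, by substitution. -/
lemma integral_le_of_deriv_le {ℓ ℓ' ρ G : ℝ → ℝ} {a b ε r : ℝ} (hab : a ≤ b) (hr : 0 < r)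
    (hε : 0 < ε) (hd : ∀ t ∈ Icc a b, HasDerivWithinAt ℓ (ℓ' t) (Icc a b) t)
    (hpos : ∀ t ∈ Icc a b, 0 < ℓ t) (hle : ∀ t ∈ Icc a b, ℓ t ≤ ε)
    (hdec : ∀ t ∈ Icc a b, ℓ' t ≤ -r * ℓ t) (hρ : ContinuousOn ρ (Icc a b))
    (hρG : ∀ t ∈ Icc a b, ρ t ≤ ℓ t * G (ℓ t)) (hG0 : ∀ s ∈ Ioc 0 ε, 0 ≤ G s)
    (hG : IntervalIntegrable G MeasureTheory.volume 0 ε) :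
    ∫ t in a..b, ρ t ≤ 1 / r * ∫ s in (0 : ℝ)..ε, G s := by
  have hanti : StrictAntiOn ℓ (Icc a b) := by
    refine strictAntiOn_of_deriv_neg (convex_Icc a b)
      (fun t ht => (hd t ht).continuousWithinAt) fun t ht => ?_
    rw [interior_Icc] at ht
    have hm := Ioo_subset_Icc_self ht
    rw [((hd t hm).hasDerivAt (Icc_mem_nhds ht.1 ht.2)).deriv]
    nlinarith [hdec t hm, hpos t hm]
  have himg : ℓ '' Icc a b ⊆ Ioc 0 ε := by
    rintro _ ⟨t, ht, rfl⟩
    exact ⟨hpos t ht, hle t ht⟩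
  have hGint : MeasureTheory.IntegrableOn G (Ioc 0 ε) :=
    (intervalIntegrable_iff_integrableOn_Ioc_of_le hε.le).1 hG
  have hsub := (MeasureTheory.integrableOn_image_iff_integrableOn_abs_deriv_smul measurableSet_Icc
    hd hanti.injOn G).1 (hGint.mono_set himg)
  rw [intervalIntegral.integral_of_le hab, intervalIntegral.integral_of_le hε.le,
    ← MeasureTheory.integral_Icc_eq_integral_Ioc]
  calc ∫ t in Icc a b, ρ t ≤ ∫ t in Icc a b, 1 / r * (|ℓ' t| • G (ℓ t)) := by
        refine MeasureTheory.setIntegral_mono_on (hρ.integrableOn_compact isCompact_Icc)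
          (hsub.const_mul _) measurableSet_Icc fun t ht => (hρG t ht).trans ?_
        have h1 := hdec t ht
        have h2 := hpos t ht
        have h3 := hG0 (ℓ t) ⟨h2, hle t ht⟩
        have h4 : r * ℓ t ≤ |ℓ' t| := by
          have := neg_abs_le (ℓ' t); linarith
        rw [smul_eq_mul, one_div, le_inv_mul_iff₀ hr, ← mul_assoc]
        exact mul_le_mul_of_nonneg_right h4 h3
    _ = 1 / r * ∫ s in ℓ '' Icc a b, G s := by
        rw [MeasureTheory.integral_const_mul,
          MeasureTheory.integral_image_eq_integral_abs_deriv_smul measurableSet_Icc hd hanti.injOn]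
    _ ≤ 1 / r * ∫ s in Ioc 0 ε, G s := by
        refine mul_le_mul_of_nonneg_left ?_ (by positivity)
        refine MeasureTheory.setIntegral_mono_set hGint ?_ himg.eventuallyLE
        exact (MeasureTheory.ae_restrict_iff' measurableSet_Ioc).2 (Eventually.of_forall hG0)

/-! ### The inverse of the compactification -/

section Compactification

variable {n : ℕ} {α β : Fin n → ℕ} {c k : ℕ}
  {f F : EuclideanSpace ℝ (Fin n) → EuclideanSpace ℝ (Fin n)}

/-- The inverse of the quasi-parabolic compactification; on the image, `κ⁻¹ = 1 - ∑ xᵢ ^ (2 βᵢ)`. -/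
noncomputable def Tinv (α β : Fin n → ℕ) (x : EuclideanSpace ℝ (Fin n)) :
    EuclideanSpace ℝ (Fin n) :=
  scale α (1 - pSum β x)⁻¹ x

lemma kappa_Tinv (hc : 0 < c) (hαβ : ∀ i, α i * β i = c) {x : EuclideanSpace ℝ (Fin n)}
    (hx : pSum β x < 1) : kappa β c (Tinv α β x) = (1 - pSum β x)⁻¹ := by
  have hq : 0 < 1 - pSum β x := sub_pos.2 hx
  have h0 := pSum_nonneg (β := β) x
  have hκ : 1 ≤ (1 - pSum β x)⁻¹ := (one_le_inv₀ hq).2 (by linarith)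
  have hp : p β c (Tinv α β x) ^ (2 * c) = ((1 - pSum β x)⁻¹) ^ (2 * c) * pSum β x := by
    rw [p_pow hc, Tinv, pSum_scale hαβ]
  refine (existsUnique_isKappa β c hc _).unique (kappa_spec β c hc _) ⟨max_le hκ ?_, ?_⟩
  · refine le_of_pow_le_pow_left₀ (n := 2 * c) (by omega) (by positivity) ?_
    rw [hp]
    exact mul_le_of_le_one_right (by positivity) hx.le
  · rw [hp]
    have h1 : ((1 - pSum β x)⁻¹) ^ (2 * c)
        = ((1 - pSum β x)⁻¹) ^ (2 * c - 1) * (1 - pSum β x)⁻¹ := by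
      rw [← pow_succ]; congr 1; omega
    rw [h1]
    field_simp
    ring

lemma Tpara_Tinv (hc : 0 < c) (hαβ : ∀ i, α i * β i = c) {x : EuclideanSpace ℝ (Fin n)}
    (hx : pSum β x < 1) : Tpara α β c (Tinv α β x) = x := by
  have hq : 0 < 1 - pSum β x := sub_pos.2 hx
  ext i
  rw [Tpara, kappa_Tinv hc hαβ hx]
  simp only [Tinv, scale_apply]
  field_simp

lemma one_sub_pSum_Tpara (hc : 0 < c) (hαβ : ∀ i, α i * β i = c) (y : EuclideanSpace ℝ (Fin n)) :
    0 < kappa β c y ∧ 1 - pSum β (Tpara α β c y) = (kappa β c y)⁻¹ := by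
  obtain ⟨h1, h2⟩ := kappa_spec β c hc y
  have hpos : 0 < kappa β c y := lt_of_lt_of_le one_pos ((le_max_left _ _).trans h1)
  refine ⟨hpos, ?_⟩
  have hT : Tpara α β c y = scale α (kappa β c y)⁻¹ y := by
    ext i; simp [Tpara, scale_apply, div_eq_inv_mul]
  have h3 : kappa β c y ^ (2 * c) = kappa β c y ^ (2 * c - 1) * kappa β c y := by
    rw [← pow_succ]; congr 1; omega
  rw [p_pow hc] at h2
  have h4 : pSum β y = kappa β c y ^ (2 * c) - kappa β c y ^ (2 * c - 1) := by linarith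
  rw [hT, pSum_scale hαβ, h4, h3, inv_pow, h3]
  field_simp
  ring

lemma pSum_Tpara_lt_one (hc : 0 < c) (hαβ : ∀ i, α i * β i = c) (y : EuclideanSpace ℝ (Fin n)) :
    pSum β (Tpara α β c y) < 1 := by
  obtain ⟨h1, h2⟩ := one_sub_pSum_Tpara hc hαβ y
  have := inv_pos.2 h1
  linarith

lemma Tinv_Tpara (hc : 0 < c) (hαβ : ∀ i, α i * β i = c) (y : EuclideanSpace ℝ (Fin n)) :
    Tinv α β (Tpara α β c y) = y := by
  obtain ⟨h1, h2⟩ := one_sub_pSum_Tpara hc hαβ y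
  ext i
  rw [Tinv, h2, inv_inv, scale_apply]
  simp only [Tpara]
  field_simp

/-- The inverse compactification carries trajectories of the desingularized field to trajectories
of `f`, up to the change of time. -/
lemma hasDerivWithinAt_Tinv (hα : ∀ i, 0 < α i) (hβ : ∀ i, 0 < β i) (hc : 0 < c)
    (hαβ : ∀ i, α i * β i = c) {x : ℝ → EuclideanSpace ℝ (Fin n)} {s : Set ℝ} {t : ℝ}
    (hx : HasDerivWithinAt x (desing α β c k f F (x t)) s t) (ht : pSum β (x t) < 1) :
    HasDerivWithinAt (fun τ => Tinv α β (x τ))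
      (timeDensity β c k (x t) • f (Tinv α β (x t))) s t := by
  have hq : 0 < 1 - pSum β (x t) := sub_pos.2 ht
  have h1 := hasDerivWithinAt_pSum (β := β) hx
  rw [sum_grad_mul_desing hα hβ hc hαβ] at h1
  rw [hasDerivWithinAt_euclidean]
  intro i
  have h2 := ((((h1.const_sub 1).fun_inv hq.ne').fun_pow (α i)).fun_mul
    (hasDerivWithinAt_euclidean.1 hx i))
  refine h2.congr_deriv ?_
  have h3 : ((1 - pSum β (x t))⁻¹) ^ (α i)
      = ((1 - pSum β (x t))⁻¹) ^ (α i - 1) * (1 - pSum β (x t))⁻¹ := by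
    rw [← pow_succ]; congr 1; have := hα i; omega
  rw [PiLp.smul_apply, smul_eq_mul, timeDensity_eq hc, desing_apply, tildeF_of_mem hc ht, pow_add, h3,
    inv_pow _ k, Tinv]
  field_simp
  ring

lemma pSum_eq_mul_pSum_Tinv (hαβ : ∀ i, α i * β i = c) {x : EuclideanSpace ℝ (Fin n)}
    (hx : pSum β x < 1) : pSum β x = (1 - pSum β x) ^ (2 * c) * pSum β (Tinv α β x) := by
  have hq : 0 < 1 - pSum β x := sub_pos.2 hx
  rw [Tinv, pSum_scale hαβ, inv_pow, mul_inv_cancel_left₀ (by positivity)]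

end Compactification

/-! ### The change of time and the blow-up -/

/-- The primitive of a positive continuous function has a differentiable inverse. -/
lemma exists_inverse_integral {ρ : ℝ → ℝ} (hρ : Continuous ρ) (hpos : ∀ t, 0 < ρ t) {L : ℝ}
    (hL : Tendsto (fun τ => ∫ σ in (0 : ℝ)..τ, ρ σ) atTop (𝓝 L)) :
    ∃ θ : ℝ → ℝ, (∀ τ, 0 ≤ τ → (∫ σ in (0 : ℝ)..τ, ρ σ) ∈ Ico 0 L ∧
        θ (∫ σ in (0 : ℝ)..τ, ρ σ) = τ) ∧
      ∀ t ∈ Ico 0 L, 0 ≤ θ t ∧ HasDerivAt θ (ρ (θ t))⁻¹ t := by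
  set e : ℝ → ℝ := fun τ => ∫ σ in (0 : ℝ)..τ, ρ σ with he
  have hd : ∀ τ, HasStrictDerivAt e (ρ τ) τ := fun τ => hρ.integral_hasStrictDerivAt 0 τ
  have hmono : StrictMono e := strictMono_of_deriv_pos fun τ => by
    rw [(hd τ).hasDerivAt.deriv]; exact hpos τ
  have hcont : Continuous e := continuous_iff_continuousAt.2 fun τ => (hd τ).hasDerivAt.continuousAt
  have h0 : e 0 = 0 := by simp [he]
  have hinv : ∀ τ, Function.invFun e (e τ) = τ := Function.leftInverse_invFun hmono.injective
  have hlt : ∀ τ, e τ < L := fun τ =>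
    (hmono (lt_add_one τ)).trans_le (hmono.monotone.ge_of_tendsto hL _)
  refine ⟨Function.invFun e, fun τ hτ => ⟨⟨?_, hlt τ⟩, hinv τ⟩, fun t ht => ?_⟩
  · exact h0.ge.trans (hmono.monotone hτ)
  · obtain ⟨b, hb, hb0⟩ := ((hL.eventually (lt_mem_nhds ht.2)).and (eventually_ge_atTop 0)).exists
    obtain ⟨τ, hτ, rfl⟩ := intermediate_value_Icc hb0 hcont.continuousOn
      (show t ∈ Icc (e 0) (e b) from ⟨by rw [h0]; exact ht.1, hb.le⟩)
    rw [hinv τ]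
    exact ⟨hτ.1, ((hd τ).to_local_left_inverse (hpos τ).ne'
      (Eventually.of_forall hinv)).hasDerivAt⟩

lemma IsTrajectoryOn.eqOn_Ico {n : ℕ} {f : EuclideanSpace ℝ (Fin n) → EuclideanSpace ℝ (Fin n)}
    (hf : ContDiff ℝ 1 f) {b : ℝ} {y z : ℝ → EuclideanSpace ℝ (Fin n)}
    (hy : IsTrajectoryOn f univ (Ico 0 b) y) (hz : IsTrajectoryOn f univ (Ico 0 b) z)
    (h0 : y 0 = z 0) : EqOn y z (Ico 0 b) := by
  intro t ht
  have hsub : Icc 0 t ⊆ Ico 0 b := Icc_subset_Ico_right ht.2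
  have hy' := hy.mono Subset.rfl hsub
  have hz' := hz.mono Subset.rfl hsub
  obtain ⟨R₁, h₁⟩ := isCompact_Icc.exists_bound_of_continuousOn hy'.continuousOn
  obtain ⟨R₂, h₂⟩ := isCompact_Icc.exists_bound_of_continuousOn hz'.continuousOn
  refine IsTrajectoryOn.eqOn (isCompact_closedBall (0 : EuclideanSpace ℝ (Fin n)) (max R₁ R₂))
    (convex_closedBall _ _) hf.contDiffOn (T := t)
    (fun s hs => ⟨?_, (hy' s hs).2⟩) (fun s hs => ⟨?_, (hz' s hs).2⟩) h0 ⟨ht.1, le_rfl⟩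
  · simpa using Or.inl (h₁ s hs)
  · simpa using Or.inr (h₂ s hs)

section BlowUp

variable {n : ℕ} {α β : Fin n → ℕ} {c k : ℕ}
  {f F : EuclideanSpace ℝ (Fin n) → EuclideanSpace ℝ (Fin n)}

/-- A global trajectory of the desingularized field that tends to a point of the horizon in finite
original time corresponds to a solution of `y' = f(y)` that blows up at that time. -/
lemma exists_blowUp_of_tendsto_horizon (hα : ∀ i, 0 < α i) (hβ : ∀ i, 0 < β i) (hc : 0 < c)
    (hαβ : ∀ i, α i * β i = c) (hf : ContDiff ℝ (⊤ : ℕ∞) f)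
    {X : ℝ → EuclideanSpace ℝ (Fin n)}
    (hX : IsTrajectoryOn (desing α β c k f F) (domain β c) (Ici 0) X)
    {xs : EuclideanSpace ℝ (Fin n)} (hxs : pSum β xs = 1) (hlim : Tendsto X atTop (𝓝 xs))
    {tmax : ℝ} (ht : Tendsto (elapsed β c k X) atTop (𝓝 tmax)) :
    IsBlowUpTime f (Tinv α β (X 0)) tmax ∧ ∃ y : ℝ → EuclideanSpace ℝ (Fin n),
      y 0 = Tinv α β (X 0) ∧ IsTrajectoryOn f univ (Ico 0 tmax) y ∧
      ∀ τ, 0 ≤ τ → elapsed β c k X τ ∈ Ico 0 tmax ∧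
        Tpara α β c (y (elapsed β c k X τ)) = X τ := by
  have hlt : ∀ τ, 0 ≤ τ → pSum β (X τ) < 1 := fun τ hτ => (mem_domain_iff hc).1 (hX τ hτ).1
  -- The density is extended by a constant to negative times.
  set ρ : ℝ → ℝ := fun σ => timeDensity β c k (X (max σ 0)) with hρdef
  have hρ : Continuous ρ := (continuous_timeDensity hc).comp
    (hX.continuousOn.comp_continuous (by fun_prop) fun σ => le_max_right σ 0)
  have hρpos : ∀ t, 0 < ρ t := fun t => timeDensity_pos hc (hlt _ (le_max_right t 0))
  have hel : ∀ τ, 0 ≤ τ → elapsed β c k X τ = ∫ σ in (0 : ℝ)..τ, ρ σ := fun τ hτ => by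
    refine intervalIntegral.integral_congr fun σ hσ => ?_
    rw [uIcc_of_le hτ] at hσ
    simp only [hρdef, max_eq_left hσ.1]
  obtain ⟨θ, hθ, hθd⟩ := exists_inverse_integral hρ hρpos
    (ht.congr' ((eventually_ge_atTop 0).mono hel))
  have hθ0 : θ 0 = 0 := by simpa using (hθ 0 le_rfl).2
  have htmax : 0 < tmax := by simpa using (hθ 0 le_rfl).1.2
  set y : ℝ → EuclideanSpace ℝ (Fin n) := fun t => Tinv α β (X (θ t)) with hy
  have hy0 : y 0 = Tinv α β (X 0) := by simp only [hy, hθ0]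
  have hytraj : IsTrajectoryOn f univ (Ico 0 tmax) y := by
    intro t htI
    obtain ⟨h0, hd⟩ := hθd t htI
    refine ⟨mem_univ _, ?_⟩
    have h1 := hasDerivWithinAt_Tinv hα hβ hc hαβ (hX (θ t) h0).2 (hlt _ h0)
    have h2 := h1.scomp t hd.hasDerivWithinAt fun s hs => (hθd s hs).1
    refine h2.congr_deriv ?_
    have h3 : ρ (θ t) = timeDensity β c k (X (θ t)) := by simp only [hρdef, max_eq_left h0]
    rw [← h3, smul_smul, inv_mul_cancel₀ (hρpos _).ne', one_smul]
  have hyel : ∀ τ, 0 ≤ τ → y (elapsed β c k X τ) = Tinv α β (X τ) := fun τ hτ => by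
    simp only [hy, hel τ hτ, (hθ τ hτ).2]
  refine ⟨⟨?_, fun b hb => hb ⟨htmax, y, hy0, hytraj⟩⟩, y, hy0, hytraj, fun τ hτ => ⟨?_, ?_⟩⟩
  · rintro b ⟨-, z, hz0, hz⟩
    by_contra! hlt'
    have heq := hytraj.eqOn_Ico (hf.of_le (by exact_mod_cast le_top))
      (hz.mono Subset.rfl (Ico_subset_Ico_right hlt'.le)) (hy0.trans hz0.symm)
    -- A solution beyond `tmax` would be bounded there, and `p` would vanish in the limit.
    have hzc : Tendsto z (𝓝[Ico 0 b] tmax) (𝓝 (z tmax)) := hz.continuousOn tmax ⟨htmax.le, hlt'⟩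
    have hte : Tendsto (elapsed β c k X) atTop (𝓝[Ico 0 b] tmax) := by
      refine tendsto_nhdsWithin_iff.2 ⟨ht, (eventually_ge_atTop 0).mono fun τ hτ => ?_⟩
      rw [hel τ hτ]
      exact ⟨(hθ τ hτ).1.1, (hθ τ hτ).1.2.trans hlt'⟩
    have h1 : Tendsto (fun τ => (1 - pSum β (X τ)) ^ (2 * c) *
        pSum β (z (elapsed β c k X τ))) atTop (𝓝 ((1 - pSum β xs) ^ (2 * c) * pSum β (z tmax))) :=
      (((tendsto_const_nhds.sub ((continuous_pSum.tendsto xs).comp hlim)).pow _).mul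
        ((continuous_pSum.tendsto _).comp (hzc.comp hte)))
    have h2 : Tendsto (fun τ => pSum β (X τ)) atTop (𝓝 1) := by
      rw [← hxs]; exact (continuous_pSum.tendsto xs).comp hlim
    have h3 := tendsto_nhds_unique (h2.congr' ((eventually_ge_atTop 0).mono fun τ hτ => ?_)) h1
    · rw [hxs, sub_self, zero_pow (by omega), zero_mul] at h3
      exact one_ne_zero h3
    · have hmem : elapsed β c k X τ ∈ Ico 0 tmax := by rw [hel τ hτ]; exact (hθ τ hτ).1
      rw [← heq hmem, hyel τ hτ]
      exact pSum_eq_mul_pSum_Tinv hαβ (hlt τ hτ)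
  · rw [hel τ hτ]; exact (hθ τ hτ).1
  · rw [hyel τ hτ, Tpara_Tinv hc hαβ (hlt τ hτ)]

end BlowUp

end QHBlowup

/-! ### Blow-up of the validated solution -/

theorem mainTheorem3 {n : ℕ} (α β : Fin n → ℕ) (c k : ℕ)
    (hα : ∀ i, 0 < α i) (hβ : ∀ i, 0 < β i) (hc : 0 < c) (hk : 0 < k)
    (hαβ : ∀ i, α i * β i = c)
    (f F : EuclideanSpace ℝ (Fin n) → EuclideanSpace ℝ (Fin n))
    (hf : QHBlowup.IsAsymptoticallyQuasiHomogeneous α k f F)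
    (y₀ : EuclideanSpace ℝ (Fin n))
    -- Step 1: an equilibrium on the horizon
    (xs : EuclideanSpace ℝ (Fin n)) (hxs : xs ∈ QHBlowup.horizon β c)
    (hxs0 : QHBlowup.desing α β c k f F xs = 0)
    -- Step 2: a Lyapunov domain with a positive definite matrix
    (Y : Matrix (Fin n) (Fin n) ℝ) (hY : Y.PosDef)
    (Nt : Set (EuclideanSpace ℝ (Fin n)))
    (hNt : QHBlowup.IsLyapunovDomain (QHBlowup.desing α β c k f F)
      (closure (QHBlowup.domain β c)) Y xs Nt)
    -- Step 3: a sublevel set inside the Lyapunov domain, and a trajectory that enters its interior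
    (ε : ℝ) (hε : 0 < ε)
    (hN : {x ∈ closure (QHBlowup.domain β c) | QHBlowup.quad Y (x - xs) ≤ ε} ⊆ Nt)
    (x : ℝ → EuclideanSpace ℝ (Fin n)) (τN : ℝ) (hτN : 0 ≤ τN)
    (hx0 : x 0 = QHBlowup.Tpara α β c y₀)
    (hx : QHBlowup.IsTrajectoryOn (QHBlowup.desing α β c k f F)
      (closure (QHBlowup.domain β c)) (Icc 0 τN) x)
    (hxN : QHBlowup.quad Y (x τN - xs) < ε)
    -- Step 4: the constants and the function in the upper bound, and the finiteness of the bound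
    (c₁ cN : ℝ) (hc₁ : 0 < c₁) (hcN : 0 < cN)
    (hcA : ∀ z ∈ Nt, ∀ v : EuclideanSpace ℝ (Fin n),
      QHBlowup.quad (QHBlowup.lyapMatrix (QHBlowup.desing α β c k f F)
        (closure (QHBlowup.domain β c)) Y z) v ≤ -(c₁ * cN) * QHBlowup.quad Y v)
    (C : ℝ → ℝ)
    (hC : ∀ z ∈ Nt, |1 - QHBlowup.p β c z ^ (2 * c)| ≤ C (QHBlowup.quad Y (z - xs)))
    (hCint : IntervalIntegrable (fun ℓ => C ℓ ^ k / ℓ) MeasureTheory.volume 0 ε) :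
    QHBlowup.IsAsymptoticallyStable (QHBlowup.desing α β c k f F)
      (closure (QHBlowup.domain β c)) xs ∧
    ∃ tmax : ℝ,
      QHBlowup.IsBlowUpTime f y₀ tmax ∧
      tmax ∈ Icc (QHBlowup.elapsed β c k x τN)
        (QHBlowup.elapsed β c k x τN + 1 / (cN * c₁) * ∫ ℓ in (0 : ℝ)..ε, C ℓ ^ k / ℓ) ∧
      ∃ y X : ℝ → EuclideanSpace ℝ (Fin n),
        -- the solution on its maximal interval of existence
        y 0 = y₀ ∧ QHBlowup.IsTrajectoryOn f univ (Ico 0 tmax) y ∧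
        -- the computed trajectory extends to a global one that tends to the equilibrium
        EqOn X x (Icc 0 τN) ∧
        QHBlowup.IsTrajectoryOn (QHBlowup.desing α β c k f F) (QHBlowup.domain β c) (Ici 0) X ∧
        Tendsto X atTop (𝓝 xs) ∧
        -- the two correspond through the compactification and the change of time
        (∀ τ, 0 ≤ τ → QHBlowup.elapsed β c k X τ ∈ Ico 0 tmax ∧
          QHBlowup.Tpara α β c (y (QHBlowup.elapsed β c k X τ)) = X τ) ∧
        Tendsto (QHBlowup.elapsed β c k X) atTop (𝓝 tmax) := by
  have hK : closure (QHBlowup.domain β c) = {z | QHBlowup.pSum β z ≤ 1} :=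
    QHBlowup.closure_domain hβ hc
  have hKc : Convex ℝ (closure (QHBlowup.domain β c)) := by
    rw [hK]; exact QHBlowup.convex_pSum_le 1
  have hxs1 : QHBlowup.pSum β xs = 1 := (QHBlowup.mem_horizon_iff hc).1 hxs
  have hr : 0 < c₁ * cN := mul_pos hc₁ hcN
  have hdec : ∀ z ∈ closure (QHBlowup.domain β c), QHBlowup.quad Y (z - xs) ≤ ε →
      2 * QHBlowup.bil Y (z - xs) (QHBlowup.desing α β c k f F z)
        ≤ -(c₁ * cN) * QHBlowup.quad Y (z - xs) := fun z hz hzε =>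
    QHBlowup.two_mul_bil_le hY hKc (hNt.1 hNt.2.2.2.1) hxs0 hN hNt.2.2.2.2 hcA hz hzε
  refine ⟨QHBlowup.isAsymptoticallyStable_of_decay hY hε hr hxs0 hdec, ?_⟩
  have h0lt : QHBlowup.pSum β (QHBlowup.Tpara α β c y₀) < 1 :=
    QHBlowup.pSum_Tpara_lt_one hc hαβ y₀
  obtain ⟨X, hX0, hX⟩ := QHBlowup.exists_global_trajectory hα hβ hc hαβ hf h0lt
  have hXx : EqOn X x (Icc 0 τN) :=
    QHBlowup.desing_eqOn hα hβ hc hαβ hf (hX.mono Subset.rfl Icc_subset_Ici_self) hx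
      (by rw [hX0]; exact h0lt) (by rw [hX0, hx0])
  have hlt : ∀ τ, 0 ≤ τ → QHBlowup.pSum β (X τ) < 1 := fun τ hτ =>
    (QHBlowup.mem_domain_iff hc).1 (hX τ hτ).1
  -- The trajectory restarted at time `τN`, inside the sublevel set of the Lyapunov function.
  have hZ : QHBlowup.IsTrajectoryOn (QHBlowup.desing α β c k f F)
      (closure (QHBlowup.domain β c)) (Ici 0) (fun s => X (s + τN)) := by
    intro s hs
    have hs' : s + τN ∈ Ici (0 : ℝ) := add_nonneg hs hτN
    refine ⟨subset_closure (hX _ hs').1, ?_⟩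
    have h1 : HasDerivWithinAt (fun s : ℝ => s + τN) 1 (Ici 0) s :=
      ((hasDerivAt_id s).add_const τN).hasDerivWithinAt
    have h2 := (hX _ hs').2.scomp s h1 fun u (hu : 0 ≤ u) => add_nonneg hu hτN
    rw [one_smul] at h2
    exact h2
  have hZ0 : QHBlowup.quad Y (X (0 + τN) - xs) ≤ ε := by
    rw [zero_add, hXx ⟨hτN, le_rfl⟩]; exact hxN.le
  have hlim : Tendsto X atTop (𝓝 xs) := by
    have h1 := QHBlowup.tendsto_of_quad_le hY hε hr hdec hZ hZ0
    have h2 := h1.comp (tendsto_atTop_add_const_right atTop (-τN) tendsto_id)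
    simpa [Function.comp_def] using h2
  have hlevel : ∀ τ, τN ≤ τ → QHBlowup.quad Y (X τ - xs) ≤ ε := fun τ hτ => by
    have h1 := (QHBlowup.quad_le_mul_exp hY hε hr hdec (T := τ - τN)
      (hZ.mono Subset.rfl Icc_subset_Ici_self) hZ0 (τ - τN) ⟨sub_nonneg.2 hτ, le_rfl⟩).1
    simpa using h1
  have hρc : ContinuousOn (fun σ => QHBlowup.timeDensity β c k (X σ)) (Ici 0) :=
    (QHBlowup.continuous_timeDensity hc).comp_continuousOn hX.continuousOn
  have hρint : ∀ a b : ℝ, 0 ≤ a → 0 ≤ b → IntervalIntegrable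
      (fun σ => QHBlowup.timeDensity β c k (X σ)) MeasureTheory.volume a b := fun a b ha hb =>
    (hρc.mono fun σ hσ => (le_min ha hb).trans hσ.1).intervalIntegrable
  have hsplit : ∀ a b : ℝ, 0 ≤ a → 0 ≤ b → QHBlowup.elapsed β c k X b
      = QHBlowup.elapsed β c k X a + ∫ σ in a..b, QHBlowup.timeDensity β c k (X σ) :=
    fun a b ha hb => (intervalIntegral.integral_add_adjacent_intervals
      (hρint 0 a le_rfl ha) (hρint a b ha hb)).symm
  have helx : QHBlowup.elapsed β c k X τN = QHBlowup.elapsed β c k x τN := by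
    refine intervalIntegral.integral_congr fun σ hσ => ?_
    rw [uIcc_of_le hτN] at hσ
    simp only [hXx hσ]
  -- `hC` gives no information on `C ℓ` for a level `ℓ` that is not attained, whence `exists_quad_eq`.
  have hC0 : ∀ ℓ ∈ Ioc 0 ε, 0 ≤ C ℓ ^ k / ℓ := by
    intro ℓ hℓ
    obtain ⟨z, hz, hzℓ⟩ := QHBlowup.exists_quad_eq hα hβ hc hαβ hY hr hxs1
      (fun z hz => hdec z (by rw [hK]; exact hz)) hℓ.1.le hℓ.2
    have h1 := hC z (hN ⟨by rw [hK]; exact hz, hzℓ.trans_le hℓ.2⟩)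
    rw [hzℓ] at h1
    exact div_nonneg (pow_nonneg ((abs_nonneg _).trans h1) _) hℓ.1.le
  have htail : ∀ τ, τN ≤ τ → ∫ σ in τN..τ, QHBlowup.timeDensity β c k (X σ)
      ≤ 1 / (cN * c₁) * ∫ ℓ in (0 : ℝ)..ε, C ℓ ^ k / ℓ := by
    intro τ hτ
    have hIci : Icc τN τ ⊆ Ici 0 := fun σ hσ => hτN.trans hσ.1
    rw [mul_comm cN]
    refine QHBlowup.integral_le_of_deriv_le (ℓ := fun σ => QHBlowup.quad Y (X σ - xs)) hτ hr hε
      (fun σ hσ => QHBlowup.hasDerivWithinAt_quad (QHBlowup.isSymm_of_posDef hY)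
        ((hX σ (hIci hσ)).2.mono hIci)) (fun σ hσ => ?_) (fun σ hσ => hlevel σ hσ.1)
      (fun σ hσ => hdec _ (subset_closure (hX σ (hIci hσ)).1) (hlevel σ hσ.1))
      (hρc.mono hIci) (fun σ hσ => ?_) hC0 hCint
    all_goals
      have hne : X σ - xs ≠ 0 := sub_ne_zero.2 fun h => by
        have := hlt σ (hIci hσ); rw [h, hxs1] at this; exact lt_irrefl _ this
      have hpos := QHBlowup.quad_pos hY hne
    · exact hpos
    · have h1 := hlt σ (hIci hσ)
      have h2 := hC (X σ) (hN ⟨subset_closure (hX σ (hIci hσ)).1, hlevel σ hσ.1⟩)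
      rw [QHBlowup.p_pow hc] at h2
      rw [mul_div_cancel₀ _ hpos.ne']
      exact (QHBlowup.timeDensity_le hc h1.le).trans
        (pow_le_pow_left₀ (sub_pos.2 h1).le ((le_abs_self _).trans h2) k)
  -- The original time along the trajectory is increasing and bounded; its limit is `tmax`.
  have hmono : MonotoneOn (QHBlowup.elapsed β c k X) (Ici 0) := by
    intro a ha b hb hab
    rw [hsplit a b ha hb]
    refine le_add_of_nonneg_right (intervalIntegral.integral_nonneg hab fun σ hσ => ?_)
    exact (QHBlowup.timeDensity_pos hc (hlt σ (le_trans ha hσ.1))).le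
  have hbd : ∀ τ, τN ≤ τ → QHBlowup.elapsed β c k X τ ∈ Icc (QHBlowup.elapsed β c k x τN)
      (QHBlowup.elapsed β c k x τN + 1 / (cN * c₁) * ∫ ℓ in (0 : ℝ)..ε, C ℓ ^ k / ℓ) := by
    intro τ hτ
    rw [← helx]
    refine ⟨hmono hτN (hτN.trans hτ) hτ, ?_⟩
    rw [hsplit τN τ hτN (hτN.trans hτ)]
    exact add_le_add_right (htail τ hτ) _
  obtain ⟨tmax, htmax⟩ : ∃ tmax, Tendsto (QHBlowup.elapsed β c k X) atTop (𝓝 tmax) := by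
    have hmono' : Monotone fun τ => QHBlowup.elapsed β c k X (max τ τN) := fun a b hab =>
      hmono (hτN.trans (le_max_right _ _)) (hτN.trans (le_max_right _ _))
        (max_le_max_right τN hab)
    refine ⟨_, (tendsto_atTop_ciSup hmono' ?_).congr' ?_⟩
    · exact ⟨_, by rintro _ ⟨τ, rfl⟩; exact (hbd _ (le_max_right _ _)).2⟩
    · filter_upwards [eventually_ge_atTop τN] with τ hτ
      rw [max_eq_left hτ]
  obtain ⟨hblow, y, hy0, hy, hyX⟩ :=
    QHBlowup.exists_blowUp_of_tendsto_horizon hα hβ hc hαβ hf.1 hX hxs1 hlim htmax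
  rw [hX0, QHBlowup.Tinv_Tpara hc hαβ] at hblow hy0
  exact ⟨tmax, hblow, isClosed_Icc.mem_of_tendsto htmax ((eventually_ge_atTop τN).mono hbd),
    y, X, hy0, hy, hXx, hX, hlim, hyX, htmax⟩
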